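/- **Setting.** Let $N\ge 2$, $0\le\alpha\le1$, $0<\theta\le\pi/4$. Put $|\psi_\theta\rangle=\cos\theta|00\rangle+\sin\theta|11\rangle$ and let $\rho_{\alpha,\theta}=\alpha|\psi_\theta\rangle\langle\psi_\theta|+(1-\alpha)\,\mathrm{Tr}_B(|\psi_\theta\rangle\langle\psi_\theta|)\otimes\frac{\mathbb 1}{2}$, a two-qubit state of systems $A,B$. Take $N$ copies, with systems $A_1,B_1,\dots,A_N,B_N$, and let $F=|0\rangle(\langle 0\cdots0|+\langle1\cdots1|)$ act on $B_1\cdots B_N$. Let $\rho_{A_1\cdots A_N}$ be the $N$-qubit state obtained by normalising $\mathrm{Tr}_B[(\mathbb 1_A\otimes F)\rho_{\alpha,\theta}^{\otimes N}(\mathbb 1_A\otimes F)^\dagger]$. For a set $S$ of parties let $\rho_S$ be its reduced state on $S$, and define the $N$-qutrit state (qutrit basis $|0\rangle,|1\rangle,|2\rangle$) $$\rho_{\rm GME}=\frac1{2^N}\sum_{S\subseteq\{1,\dots,N\}}\rho_S\otimes(|2\rangle\langle2|)^{\otimes S^c}.$$ Let $G_\epsilon=\epsilon|0\rangle\langle0|+|1\rangle\langle1|$,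 let $\rho_\epsilon=G_\epsilon^{\otimes N}\rho_{\rm GME}G_\epsilon^{\otimes N}/\mathrm{Tr}[G_\epsilon^{\otimes N}\rho_{\rm GME}G_\epsilon^{\otimes N}]$, and let $|\mathrm{GHZ}\rangle=(|0\rangle^{\otimes N}+|1\rangle^{\otimes N})/\sqrt2$. **Notions.** A *bipartition* splits the $N$ parties into two non-empty blocks. An $N$-party state is *genuinely multipartite entangled* (GME) if it is not a finite convex combination of pure states each of which is a product across some bipartition. It is *fully local* if, for all families of local POVMs $M_{a_n|x_n}$ with finitely many outcomes, $\mathrm{Tr}[\rho\bigotimes_n M_{a_n|x_n}]=\int\prod_n p_\lambda(a_n|x_n)\,d\mu(\lambda)$ for some probability measure $\mu$ and local response functions $p_\lambda$. Correlations $p(\mathbf a|\mathbf x)$ are *bilocal* if $p(\mathbf a|\mathbf x)=\sum_{(b,\bar b)}p_b\int p^b_\lambda(\mathbf a_b|\mathbf x_b)\,p^b_\lambda(\mathbf a_{\bar b}|\mathbf x_{\bar b})\,d\mu_b(\lambda)$, where $(b,\bar b)$ runs over the bipartitions, the $p_b$ are probability weights, the $\mu_b$ are probability measures, and the distributions inside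 a block are arbitrary (possibly signalling). A state is *genuinely multipartite nonlocal* (GMNL) if finitely many local POVMs on it yield correlations that are not bilocal. It is *GMNL under sequential measurements* if there are local measurements with Kraus operators $K_{c|z}$ ($\sum_cK_{c|z}^\dagger K_{c|z}=\mathbb 1$), followed by local POVMs $M_{a|x}$ on the resulting systems (finitely many inputs and outcomes), whose joint statistics $p(\mathbf c,\mathbf a|\mathbf z,\mathbf x)$ have no time-ordered bilocal model, i.e. no model of the above form in which each block has a response $p_\lambda(\mathbf c_b|\mathbf z_b)\,p_\lambda(\mathbf a_b|\mathbf x_b,\mathbf c_b,\mathbf z_b)$. **Theorem.** Let $N\ge2$. 1. For all $0\le\alpha\le1$ and $0<\theta\le\pi/4$, $\rho_{\rm GME}$ and $\rho_{\tan\theta}$ are (well-defined) states and $$\langle\mathrm{GHZ}|\rho_{\tan\theta}|\mathrm{GHZ}\rangle=\tfrac12\Big[\alpha^N+\big(\tfrac{1+\alpha}2\big)^N+\big(\tfrac{1-\alpha}2\big)^N\Big].$$ 2. This fidelity tends to $1$ as $\alpha\to1^-$, for any choice of $\theta=\theta(\alpha)\in(0,\pi/4]$. 3. There is $\alpha_0<1$,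 depending only on $N$, such that for every $\alpha\in(\alpha_0,1)$: (a) some $\theta\in(0,\pi/4]$ satisfies $\cos^2(2\theta)\ge\frac{2\alpha-1}{(2-\alpha)\alpha^3}$; (b) for every $\theta\in(0,\pi/4]$, $\rho_{\rm GME}$ is GME, the filtered state $\rho_{\tan\theta}$ is GMNL, and $\rho_{\rm GME}$ is GMNL under sequential measurements; (c) if moreover $\theta$ satisfies the inequality in (a), then $\rho_{\rm GME}$ is fully local. In particular, for every $N\ge2$ there are fully local GME states that exhibit genuine multipartite hidden nonlocality. -/

import Mathlib

namespace HiddenNonlocality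

open Matrix MeasureTheory
open scoped Kronecker ComplexOrder

noncomputable section

/-! ### States of `N` parties

Each party holds a copy of `ℂ^d` with basis `Fin d`; the joint space has the product basis
`Fin N → Fin d`, and operators are matrices in that basis. -/

/-- Operators on `(ℂ^d)^{⊗N}`. -/
abbrev MultiOp (N d : ℕ) := Matrix (Fin N → Fin d) (Fin N → Fin d) ℂ

/-- Density operators. -/
def IsState {ι : Type} [Fintype ι] (ρ : Matrix ι ι ℂ) : Prop :=
  ρ.PosSemidef ∧ ρ.trace = 1

/-- The product operator `M 0 ⊗ ⋯ ⊗ M (N-1)`. -/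
def tensor {N d : ℕ} (M : Fin N → Matrix (Fin d) (Fin d) ℂ) : MultiOp N d :=
  Matrix.of fun i j => ∏ n, M n (i n) (j n)

/-- The rank-one operator `|v⟩⟨v|`. -/
def ketbra {ι : Type} (v : ι → ℂ) : Matrix ι ι ℂ := vecMulVec v (star v)

/-- Partial trace over the second tensor factor. -/
def traceRight {ι κ : Type} [Fintype κ] (M : Matrix (ι × κ) (ι × κ) ℂ) : Matrix ι ι ℂ :=
  Matrix.of fun i j => ∑ k, M (i, k) (j, k)

/-- Division of an operator by its trace. -/
def normalize {ι : Type} [Fintype ι] (M : Matrix ι ι ℂ) : Matrix ι ι ℂ :=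
  (M.trace)⁻¹ • M

/-! ### Genuine multipartite entanglement -/

/-- The bipartitions `(b, bᶜ)` of the parties, both blocks being non-empty. (Each unordered
bipartition is listed once for each choice of its first block, which changes no mixture.) -/
def bipartitions (N : ℕ) : Finset (Finset (Fin N)) :=
  Finset.univ.filter fun b => b.Nonempty ∧ bᶜ.Nonempty

/-- The product vector `Φ_b ⊗ Ψ_{bᶜ}`. -/
def bipartiteVec {N d : ℕ} (b : Finset (Fin N))
    (Φ : (b → Fin d) → ℂ) (Ψ : ((bᶜ : Finset (Fin N)) → Fin d) → ℂ) : (Fin N → Fin d) → ℂ :=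
  fun i => Φ (fun n => i n) * Ψ (fun n => i n)

/-- Biseparability: `ρ = ∑_b p_b ∑_j q^b_j |Φ_j⟩⟨Φ_j|_b ⊗ |Ψ_j⟩⟨Ψ_j|_{bᶜ}`. -/
def IsBiseparable {N d : ℕ} (ρ : MultiOp N d) : Prop :=
  ∃ (k : ℕ) (p : Finset (Fin N) → ℝ) (q : Finset (Fin N) → Fin k → ℝ)
    (Φ : (b : Finset (Fin N)) → Fin k → (b → Fin d) → ℂ)
    (Ψ : (b : Finset (Fin N)) → Fin k → ((bᶜ : Finset (Fin N)) → Fin d) → ℂ),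
    (∀ b ∈ bipartitions N, 0 ≤ p b) ∧ ∑ b ∈ bipartitions N, p b = 1 ∧
    (∀ b ∈ bipartitions N, (∀ j, 0 ≤ q b j) ∧ ∑ j, q b j = 1) ∧
    (∀ b ∈ bipartitions N, ∀ j, star (Φ b j) ⬝ᵥ Φ b j = 1 ∧ star (Ψ b j) ⬝ᵥ Ψ b j = 1) ∧
    ρ = ∑ b ∈ bipartitions N, (p b : ℂ) •
          ∑ j, (q b j : ℂ) • ketbra (bipartiteVec b (Φ b j) (Ψ b j))

/-- Genuinely multipartite entangled states. -/
def IsGME {N d : ℕ} (ρ : MultiOp N d) : Prop :=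
  IsState ρ ∧ ¬ IsBiseparable ρ

/-! ### Measurements and correlations -/

/-- `M x a` are the measurement operators of POVMs labelled by `x` with outcomes `a`. -/
def IsPOVM {d : ℕ} {X A : Type} [Fintype A] (M : X → A → Matrix (Fin d) (Fin d) ℂ) : Prop :=
  ∀ x, (∀ a, (M x a).PosSemidef) ∧ ∑ a, M x a = 1

/-- The statistics `p(a|x) = Tr[ρ ⨂ₙ M_{aₙ|xₙ}]`. -/
def born {N d : ℕ} {X A : Type} (ρ : MultiOp N d)
    (M : Fin N → X → A → Matrix (Fin d) (Fin d) ℂ) (x : Fin N → X) (a : Fin N → A) : ℝ :=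
  (ρ * tensor fun n => M n (x n) (a n)).trace.re

/-- `P i` is, for every input `i`, a probability distribution over outputs. -/
def IsResponse {I O : Type} [Fintype O] (P : I → O → ℝ) : Prop :=
  ∀ i, (∀ o, 0 ≤ P i o) ∧ ∑ o, P i o = 1

/-- Correlations with a (fully) local hidden variable model
`p(a|x) = ∫ p_l(a₁|x₁) ⋯ p_l(a_N|x_N) dμ(l)`. -/
def HasLHVModel {N : ℕ} {X A : Type} [Fintype A]
    (p : (Fin N → X) → (Fin N → A) → ℝ) : Prop :=
  ∃ (L : Type) (_ : MeasurableSpace L) (μ : Measure L) (P : Fin N → L → X → A → ℝ),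
    IsProbabilityMeasure μ ∧
    (∀ n l, IsResponse (P n l)) ∧
    (∀ n x a, Measurable fun l => P n l x a) ∧
    ∀ x a, p x a = ∫ l, ∏ n, P n l (x n) (a n) ∂μ

/-- A state is fully local if for all families of local POVMs, with an arbitrary (possibly
infinite) set of labels, the statistics have a local hidden variable model. The label set may be
the set of all POVMs, so that one model serves all measurements at once. -/
def IsFullyLocal {N d : ℕ} (ρ : MultiOp N d) : Prop :=
  ∀ (X A : Type) [Fintype A] (M : Fin N → X → A → Matrix (Fin d) (Fin d) ℂ),
    (∀ n, IsPOVM (M n)) → HasLHVModel (born ρ M)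

/-- Correlations that are mixtures of correlations each local across some bipartition,
`p(a|x) = ∑_b w_b ∫ P_l(a_b|x_b) Q_l(a_{bᶜ}|x_{bᶜ}) dμ_b(l)`, where the distributions within a
block are unrestricted (they may be signalling). -/
def IsBilocal {N : ℕ} {X A : Type} [Fintype A]
    (p : (Fin N → X) → (Fin N → A) → ℝ) : Prop :=
  ∃ (L : Type) (_ : MeasurableSpace L) (w : Finset (Fin N) → ℝ)
    (μ : Finset (Fin N) → Measure L)
    (P : (b : Finset (Fin N)) → L → (b → X) → (b → A) → ℝ)
    (Q : (b : Finset (Fin N)) → L →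
      ((bᶜ : Finset (Fin N)) → X) → ((bᶜ : Finset (Fin N)) → A) → ℝ),
    (∀ b ∈ bipartitions N, 0 ≤ w b) ∧ ∑ b ∈ bipartitions N, w b = 1 ∧
    (∀ b ∈ bipartitions N, IsProbabilityMeasure (μ b)) ∧
    (∀ b ∈ bipartitions N, ∀ l, IsResponse (P b l) ∧ IsResponse (Q b l)) ∧
    (∀ b ∈ bipartitions N, ∀ x a, Measurable fun l => P b l x a) ∧
    (∀ b ∈ bipartitions N, ∀ x a, Measurable fun l => Q b l x a) ∧
    ∀ x a, p x a = ∑ b ∈ bipartitions N, w b *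
      ∫ l, P b l (fun n => x n) (fun n => a n) * Q b l (fun n => x n) (fun n => a n) ∂(μ b)

/-- Genuine multipartite nonlocality of a state: finitely many local POVMs with finitely many
outcomes give statistics which are not bilocal. -/
def IsGMNL {N d : ℕ} (ρ : MultiOp N d) : Prop :=
  ∃ (m k : ℕ) (M : Fin N → Fin m → Fin k → Matrix (Fin d) (Fin d) ℂ),
    (∀ n, IsPOVM (M n)) ∧ ¬ IsBilocal (born ρ M)

/-! ### Sequences of two local measurements -/

/-- `K z c` are the Kraus operators of measurements labelled by `z` with outcomes `c`; outcome `c`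
transforms the state by `σ ↦ K σ Kᴴ`. -/
def IsInstrument {d : ℕ} {Z C : Type} [Fintype C]
    (K : Z → C → Matrix (Fin d) (Fin d) ℂ) : Prop :=
  ∀ z, ∑ c, (K z c)ᴴ * K z c = 1

/-- Statistics `p(c,a|z,x)` when every party first performs a measurement with Kraus operators
`K_{c|z}` and then the POVM `M_{a|x}` on the resulting system. -/
def seqBorn {N d : ℕ} {Z C X A : Type} (ρ : MultiOp N d)
    (K : Fin N → Z → C → Matrix (Fin d) (Fin d) ℂ)
    (M : Fin N → X → A → Matrix (Fin d) (Fin d) ℂ)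
    (z : Fin N → Z) (c : Fin N → C) (x : Fin N → X) (a : Fin N → A) : ℝ :=
  ((tensor fun n => K n (z n) (c n)) * ρ * (tensor fun n => K n (z n) (c n))ᴴ *
    tensor fun n => M n (x n) (a n)).trace.re

/-- Time-ordered bilocal models of sequential correlations: given the hidden variable, a block of
a bipartition produces its first outcomes from its first inputs alone, and then its second outcomes
from its second inputs and the whole history of the block. -/
def IsSeqBilocal {N : ℕ} {Z C X A : Type} [Fintype C] [Fintype A]
    (p : (Fin N → Z) → (Fin N → C) → (Fin N → X) → (Fin N → A) → ℝ) : Prop :=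
  ∃ (L : Type) (_ : MeasurableSpace L) (w : Finset (Fin N) → ℝ)
    (μ : Finset (Fin N) → Measure L)
    (P₁ : (b : Finset (Fin N)) → L → (b → Z) → (b → C) → ℝ)
    (P₂ : (b : Finset (Fin N)) → L → (b → Z) → (b → C) → (b → X) → (b → A) → ℝ)
    (Q₁ : (b : Finset (Fin N)) → L →
      ((bᶜ : Finset (Fin N)) → Z) → ((bᶜ : Finset (Fin N)) → C) → ℝ)
    (Q₂ : (b : Finset (Fin N)) → L →
      ((bᶜ : Finset (Fin N)) → Z) → ((bᶜ : Finset (Fin N)) → C) →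
      ((bᶜ : Finset (Fin N)) → X) → ((bᶜ : Finset (Fin N)) → A) → ℝ),
    (∀ b ∈ bipartitions N, 0 ≤ w b) ∧ ∑ b ∈ bipartitions N, w b = 1 ∧
    (∀ b ∈ bipartitions N, IsProbabilityMeasure (μ b)) ∧
    (∀ b ∈ bipartitions N, ∀ l, IsResponse (P₁ b l) ∧ IsResponse (Q₁ b l)) ∧
    (∀ b ∈ bipartitions N, ∀ l z c, IsResponse (P₂ b l z c)) ∧
    (∀ b ∈ bipartitions N, ∀ l z c, IsResponse (Q₂ b l z c)) ∧
    (∀ b ∈ bipartitions N, ∀ z c, Measurable fun l => P₁ b l z c) ∧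
    (∀ b ∈ bipartitions N, ∀ z c x a, Measurable fun l => P₂ b l z c x a) ∧
    (∀ b ∈ bipartitions N, ∀ z c, Measurable fun l => Q₁ b l z c) ∧
    (∀ b ∈ bipartitions N, ∀ z c x a, Measurable fun l => Q₂ b l z c x a) ∧
    ∀ z c x a, p z c x a = ∑ b ∈ bipartitions N, w b *
      ∫ l, (P₁ b l (fun n => z n) (fun n => c n) *
            P₂ b l (fun n => z n) (fun n => c n) (fun n => x n) (fun n => a n)) *
           (Q₁ b l (fun n => z n) (fun n => c n) *
            Q₂ b l (fun n => z n) (fun n => c n) (fun n => x n) (fun n => a n)) ∂(μ b)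

/-- Genuine multipartite nonlocality under sequences of local measurements. -/
def IsSeqGMNL {N d : ℕ} (ρ : MultiOp N d) : Prop :=
  ∃ (mz kc m k : ℕ) (K : Fin N → Fin mz → Fin kc → Matrix (Fin d) (Fin d) ℂ)
    (M : Fin N → Fin m → Fin k → Matrix (Fin d) (Fin d) ℂ),
    (∀ n, IsInstrument (K n)) ∧ (∀ n, IsPOVM (M n)) ∧ ¬ IsSeqBilocal (seqBorn ρ K M)

/-! ### The states -/

/-- `|ψ_θ⟩ = cos θ |00⟩ + sin θ |11⟩`. -/
def psi (θ : ℝ) : Fin 2 × Fin 2 → ℂ :=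
  (Real.cos θ : ℂ) • Pi.single (0, 0) 1 + (Real.sin θ : ℂ) • Pi.single (1, 1) 1

/-- `ρ_{α,θ} = α |ψ_θ⟩⟨ψ_θ| + (1 - α) Tr_B |ψ_θ⟩⟨ψ_θ| ⊗ 𝟙/2`, the first factor being Alice's. -/
def rhoPair (α θ : ℝ) : Matrix (Fin 2 × Fin 2) (Fin 2 × Fin 2) ℂ :=
  (α : ℂ) • ketbra (psi θ) +
    (1 - α : ℂ) • (traceRight (ketbra (psi θ)) ⊗ₖ ((1 / 2 : ℂ) • (1 : Matrix (Fin 2) (Fin 2) ℂ)))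

/-- `ρ^{⊗N}` for a two-qubit operator, arranged as an operator on
`(A₁ ⊗ ⋯ ⊗ A_N) ⊗ (B₁ ⊗ ⋯ ⊗ B_N)`. -/
def starPower (N : ℕ) (ρ : Matrix (Fin 2 × Fin 2) (Fin 2 × Fin 2) ℂ) :
    Matrix ((Fin N → Fin 2) × (Fin N → Fin 2)) ((Fin N → Fin 2) × (Fin N → Fin 2)) ℂ :=
  Matrix.of fun i j => ∏ n, ρ (i.1 n, i.2 n) (j.1 n, j.2 n)

/-- `F_B = |0⟩(⟨0⋯0| + ⟨1⋯1|)`. -/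
def centralKraus (N : ℕ) : Matrix (Fin 2) (Fin N → Fin 2) ℂ :=
  vecMulVec (Pi.single 0 1) (Pi.single (fun _ => 0) 1 + Pi.single (fun _ => 1) 1)

/-- `ρ_{A₁⋯A_N}`: apply `σ ↦ F_B σ F_Bᴴ` to the central systems of `ρ_{α,θ}^{⊗N}`, trace them out
and normalise. -/
def rhoNetwork (N : ℕ) (α θ : ℝ) : MultiOp N 2 :=
  normalize (traceRight
    (((1 : MultiOp N 2) ⊗ₖ centralKraus N) * starPower N (rhoPair α θ) *
      ((1 : MultiOp N 2) ⊗ₖ centralKraus N)ᴴ))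

/-- The reduced state of the parties in `S`. -/
def reduced {N : ℕ} (S : Finset (Fin N)) (ρ : MultiOp N 2) :
    Matrix (S → Fin 2) (S → Fin 2) ℂ :=
  Matrix.of fun i j => ∑ k : ((Sᶜ : Finset (Fin N)) → Fin 2),
    ρ (fun n => if h : n ∈ S then i ⟨n, h⟩ else k ⟨n, Finset.mem_compl.2 h⟩)
      (fun n => if h : n ∈ S then j ⟨n, h⟩ else k ⟨n, Finset.mem_compl.2 h⟩)

/-- The isometry `|i⟩_S ↦ |i⟩_S ⊗ |2⋯2⟩_{Sᶜ}` from the qubits of the parties in `S` into `N`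
qutrits. -/
def padTwo {N : ℕ} (S : Finset (Fin N)) : Matrix (Fin N → Fin 3) (S → Fin 2) ℂ :=
  Matrix.of fun t i =>
    if t = (fun n => if h : n ∈ S then (i ⟨n, h⟩).castSucc else 2) then 1 else 0

/-- `ρ_GME`, the uniform mixture over all sets `S` of parties (`S` being everyone for the first
term) of `ρ_S ⊗ |2⟩⟨2|^{⊗ Sᶜ}`, where `ρ_S` is the reduced state of `ρ_{A₁⋯A_N}`. -/
def rhoGME (N : ℕ) (α θ : ℝ) : MultiOp N 3 :=
  (1 / 2 ^ N : ℂ) • ∑ S : Finset (Fin N),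
    padTwo S * reduced S (rhoNetwork N α θ) * (padTwo S)ᴴ

/-- The filter `G_ε = ε |0⟩⟨0| + |1⟩⟨1|` on a qutrit. -/
def filterOp (ε : ℝ) : Matrix (Fin 3) (Fin 3) ℂ := Matrix.diagonal ![(ε : ℂ), 1, 0]

/-- The state obtained from `ρ` when all parties succeed with the filter `G_ε`. -/
def filtered {N : ℕ} (ε : ℝ) (ρ : MultiOp N 3) : MultiOp N 3 :=
  normalize ((tensor fun _ => filterOp ε) * ρ * (tensor fun _ => filterOp ε))

/-- `|GHZ⟩ = (|0⋯0⟩ + |1⋯1⟩)/√2` in `N` qutrits. -/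
def ghz (N : ℕ) : (Fin N → Fin 3) → ℂ :=
  ((1 / Real.sqrt 2 : ℝ) : ℂ) • (Pi.single (fun _ => 0) 1 + Pi.single (fun _ => 1) 1)

/-- The fidelity `⟨v|ρ|v⟩` of `ρ` with the pure state `|v⟩⟨v|`. -/
def fidelityPure {ι : Type} [Fintype ι] (ρ : Matrix ι ι ℂ) (v : ι → ℂ) : ℂ :=
  star v ⬝ᵥ (ρ *ᵥ v)

/-- The sufficient condition on `(α, θ)` for `ρ_{α,θ}` to be unsteerable. -/
def UnsteerableCond (α θ : ℝ) : Prop :=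
  (2 * α - 1) / ((2 - α) * α ^ 3) ≤ Real.cos (2 * θ) ^ 2

end

end HiddenNonlocality

open HiddenNonlocality Filter Topology

/-!
Let `Λ` be the diagonal matrix of the Schmidt coefficients of `|ψ_θ⟩`. An effect `Q` of Alice steers
Bob's half of `ρ_{α,θ}` to `α (Λ Q Λ)ᵀ + (1 - α) tr (Λ Q Λ) 𝟙/2`, so the statistics of the network
state are a sum over `s, t` of products over the parties of the matrix elements `⟨s|·|t⟩` of such
operators. Losing a qubit with probability `1/2` turns a qutrit effect `M` into half the qubit
effect `M' + ⟨2|M|2⟩ 𝟙`, where `M'` is the restriction of `M` to the levels `0` and `1`.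

The filter `G_{tan θ}` removes the flag level and equalises the Schmidt coefficients, which leaves
the network state of isotropic sources, a noisy GHZ state independent of `θ`. A GHZ fidelity above
`1/2` after local filtering is impossible for biseparable states, since filtering preserves vectors
that are products across a bipartition. Equatorial measurements violate the Svetlichny inequality
as soon as `α ^ N > 1 / √2`, and taking the filter as first measurement turns this into a violation
for sequential measurements.

For the local model every source distributes a Gaussian vector `ψ ∈ ℂ²`. In the unsteerable range
the operators steered by Alice, whitened by `ρ_B^{-1/2}`, are averages of `f ψ |ψ⟩⟨ψ|` with
responses `f` built from caps of the Bloch sphere. The responses to the effects of a measurement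
need not sum to `1`, but each is at most the trace of its effect, so the sum is at most `2` and the
factor `1/2` coming from the lost qubits absorbs the excess. Finally, the probability of the central
outcome given the vectors of all sources is nonnegative and serves as the density of the
distribution of the hidden variable.
-/

namespace HiddenNonlocality

open Matrix MeasureTheory
open scoped Kronecker ComplexOrder

noncomputable section

/-! ### Configurations and product operators -/

section Configurations

variable {ι β γ : Type*} [Fintype ι] [DecidableEq ι]

/-- The configuration equal to `k` on `S` and to `m` on `Sᶜ`. -/
def glue (S : Finset ι) (k : S → β) (m : (Sᶜ : Finset ι) → β) : ι → β :=
  fun n => if h : n ∈ S then k ⟨n, h⟩ else m ⟨n, Finset.mem_compl.2 h⟩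

lemma glue_apply_mem (S : Finset ι) (k : S → β) (m : (Sᶜ : Finset ι) → β) (n : S) :
    glue S k m n = k n := by
  simp [glue]

lemma glue_apply_compl (S : Finset ι) (k : S → β) (m : (Sᶜ : Finset ι) → β)
    (n : (Sᶜ : Finset ι)) : glue S k m n = m n := by
  simp [glue, Finset.mem_compl.1 n.2]

/-- Configurations correspond to pairs of configurations on `S` and on `Sᶜ`. -/
def glueEquiv (S : Finset ι) : (S → β) × ((Sᶜ : Finset ι) → β) ≃ (ι → β) where
  toFun q := glue S q.1 q.2
  invFun x := (fun n => x n, fun n => x n)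
  left_inv q := Prod.ext (funext (glue_apply_mem S q.1 q.2)) (funext (glue_apply_compl S q.1 q.2))
  right_inv x := by
    ext n
    simp [glue]

lemma sum_eq_sum_glue {M : Type*} [Fintype β] [AddCommMonoid M] (S : Finset ι)
    (F : (ι → β) → M) : ∑ x, F x = ∑ k, ∑ m, F (glue S k m) := by
  rw [← (glueEquiv S).sum_comp, Fintype.sum_prod_type]
  rfl

lemma prod_eq_prod_mul_prod_compl {M : Type*} [CommMonoid M] (S : Finset ι) (f : ι → M) :
    ∏ n, f n = (∏ n : S, f n) * ∏ n : (Sᶜ : Finset ι), f n := by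
  rw [← Finset.prod_mul_prod_compl S f, Finset.prod_coe_sort S f, Finset.prod_coe_sort Sᶜ f]

lemma sum_sum_prod {R : Type*} [Fintype β] [Fintype γ] [CommSemiring R] (f : ι → β → γ → R) :
    ∑ i : ι → β, ∑ j : ι → γ, ∏ n, f n (i n) (j n) = ∏ n, ∑ a, ∑ b, f n a b := by
  simp_rw [Finset.prod_univ_sum, Fintype.piFinset_univ]

end Configurations

section Tensor

variable {N d : ℕ}

lemma tensor_one : tensor (fun _ : Fin N => (1 : Matrix (Fin d) (Fin d) ℂ)) = 1 := by
  ext i j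
  simp_rw [tensor, of_apply, one_apply, Finset.prod_ite_zero, funext_iff, Finset.mem_univ,
    forall_const, Finset.prod_const_one]

lemma tensor_mul_tensor (A B : Fin N → Matrix (Fin d) (Fin d) ℂ) :
    tensor A * tensor B = tensor fun n => A n * B n := by
  ext i j
  simp only [tensor, mul_apply, of_apply, ← Finset.prod_mul_distrib, Finset.prod_univ_sum,
    Fintype.piFinset_univ]

lemma tensor_sum {A : Type} [Fintype A] (M : Fin N → A → Matrix (Fin d) (Fin d) ℂ) :
    (tensor fun n => ∑ a, M n a) = ∑ a : Fin N → A, tensor fun n => M n (a n) := by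
  ext i j
  simp only [tensor, of_apply, Matrix.sum_apply, Finset.prod_univ_sum, Fintype.piFinset_univ]

lemma tensor_smul (c : Fin N → ℂ) (M : Fin N → Matrix (Fin d) (Fin d) ℂ) :
    (tensor fun n => c n • M n) = (∏ n, c n) • tensor M := by
  ext i j
  simp [tensor, Finset.prod_mul_distrib]

lemma conjTranspose_tensor (A : Fin N → Matrix (Fin d) (Fin d) ℂ) :
    (tensor A)ᴴ = tensor fun n => (A n)ᴴ := by
  ext i j
  simp [tensor, star_prod]

lemma trace_tensor (A : Fin N → Matrix (Fin d) (Fin d) ℂ) :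
    (tensor A).trace = ∏ n, (A n).trace := by
  simp only [trace, diag_apply, tensor, of_apply, Finset.prod_univ_sum, Fintype.piFinset_univ]

lemma tensor_single (i j : Fin N → Fin d) :
    (tensor fun n => single (i n) (j n) (1 : ℂ)) = single i j 1 := by
  ext k l
  simp_rw [tensor, of_apply, single_apply, Finset.prod_ite_zero, funext_iff, Finset.mem_univ,
    forall_const, Finset.prod_const_one, forall_and]

end Tensor

/-! ### Positivity and normalisation -/

section Positivity

variable {ι κ : Type} {N : ℕ}

lemma ketbra_posSemidef [Finite ι] (v : ι → ℂ) : (ketbra v).PosSemidef :=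
  posSemidef_vecMulVec_self_star v

lemma traceRight_posSemidef [Fintype κ] {M : Matrix (ι × κ) (ι × κ) ℂ} (hM : M.PosSemidef) :
    (traceRight M).PosSemidef := by
  have h : traceRight M = ∑ k, M.submatrix (fun i => (i, k)) (fun i => (i, k)) := by
    ext i j
    simp [traceRight, Matrix.sum_apply]
  rw [h]
  exact posSemidef_sum _ fun k _ => hM.submatrix _

lemma reduced_apply (S : Finset (Fin N)) (ρ : MultiOp N 2) (i j : S → Fin 2) :
    reduced S ρ i j = ∑ k, ρ (glue S i k) (glue S j k) := rfl

lemma reduced_posSemidef (S : Finset (Fin N)) {ρ : MultiOp N 2} (hρ : ρ.PosSemidef) :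
    (reduced S ρ).PosSemidef := by
  have h : reduced S ρ = ∑ k, ρ.submatrix (fun i => glue S i k) (fun i => glue S i k) := by
    ext i j
    simp [reduced_apply, Matrix.sum_apply]
  rw [h]
  exact posSemidef_sum _ fun k _ => hρ.submatrix _

lemma starPower_mul (ρ σ : Matrix (Fin 2 × Fin 2) (Fin 2 × Fin 2) ℂ) :
    starPower N (ρ * σ) = starPower N ρ * starPower N σ := by
  ext i j
  simp only [starPower, of_apply, mul_apply, Fintype.sum_prod_type, ← Finset.prod_mul_distrib]
  exact (sum_sum_prod fun n a b => ρ (i.1 n, i.2 n) (a, b) * σ (a, b) (j.1 n, j.2 n)).symm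

lemma conjTranspose_starPower (ρ : Matrix (Fin 2 × Fin 2) (Fin 2 × Fin 2) ℂ) :
    (starPower N ρ)ᴴ = starPower N ρᴴ := by
  ext i j
  simp [starPower, star_prod]

open scoped MatrixOrder Matrix.Norms.L2Operator in
lemma starPower_posSemidef {ρ : Matrix (Fin 2 × Fin 2) (Fin 2 × Fin 2) ℂ} (hρ : ρ.PosSemidef) :
    (starPower N ρ).PosSemidef := by
  obtain ⟨V, rfl⟩ := CStarAlgebra.nonneg_iff_eq_star_mul_self.mp hρ.nonneg
  rw [star_eq_conjTranspose, starPower_mul, ← conjTranspose_starPower]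
  exact posSemidef_conjTranspose_mul_self _

variable [Fintype ι]

lemma normalize_posSemidef {M : Matrix ι ι ℂ} (hM : M.PosSemidef) : (normalize M).PosSemidef :=
  hM.smul (inv_nonneg.2 hM.trace_nonneg)

lemma isState_normalize {M : Matrix ι ι ℂ} (hM : M.PosSemidef) (h : M.trace ≠ 0) :
    IsState (normalize M) :=
  ⟨normalize_posSemidef hM, by rw [normalize, trace_smul, smul_eq_mul, inv_mul_cancel₀ h]⟩

end Positivity

/-! ### Star networks of two-qubit operators -/

/-- The operator left with the outer parties of a star network with `N` sources `ρ`, before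
normalisation. -/
def starNetwork (N : ℕ) (ρ : Matrix (Fin 2 × Fin 2) (Fin 2 × Fin 2) ℂ) : MultiOp N 2 :=
  traceRight (((1 : MultiOp N 2) ⊗ₖ centralKraus N) * starPower N ρ *
    ((1 : MultiOp N 2) ⊗ₖ centralKraus N)ᴴ)

/-- The block `⟨s|ρ|t⟩` of a two-qubit operator, taken in the second factor. -/
def rightBlock (ρ : Matrix (Fin 2 × Fin 2) (Fin 2 × Fin 2) ℂ) (s t : Fin 2) :
    Matrix (Fin 2) (Fin 2) ℂ :=
  ρ.submatrix (fun i => (i, s)) (fun i => (i, t))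

lemma starNetwork_posSemidef {N : ℕ} {ρ : Matrix (Fin 2 × Fin 2) (Fin 2 × Fin 2) ℂ}
    (hρ : ρ.PosSemidef) : (starNetwork N ρ).PosSemidef :=
  traceRight_posSemidef ((starPower_posSemidef hρ).mul_mul_conjTranspose_same _)

lemma starNetwork_eq_sum_tensor (N : ℕ) (ρ : Matrix (Fin 2 × Fin 2) (Fin 2 × Fin 2) ℂ) :
    starNetwork N ρ = ∑ s, ∑ t, tensor fun _ => rightBlock ρ s t := by
  ext i j
  have hF (k : Fin 2) (y : Fin N → Fin 2) : centralKraus N k y =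
      if k = 0 then ((if y = (fun _ => 0) then 1 else 0) + if y = (fun _ => 1) then 1 else 0)
        else 0 := by
    simp [centralKraus, vecMulVec_apply, Pi.single_apply]
  simp only [starNetwork, traceRight, of_apply, mul_apply, Fintype.sum_prod_type,
    kroneckerMap_apply, conjTranspose_apply, hF, one_apply, Fin.sum_univ_two, Matrix.add_apply]
  simp only [↓reduceIte, one_ne_zero, mul_zero, zero_mul, Finset.sum_const_zero, star_zero,
    ite_mul, one_mul, Finset.sum_ite_eq, Finset.mem_univ, add_mul, Finset.sum_add_distrib,
    mul_ite, Finset.sum_ite_eq', apply_ite star, star_add, star_one, mul_add, mul_one, add_zero,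
    starPower, tensor, rightBlock, submatrix_apply, of_apply]
  ring

/-! ### The erasure mixture -/

/-- The equal mixture over all sets `S` of parties of `ρ_S ⊗ |2⟩⟨2|^{⊗ Sᶜ}`, so that each party
independently loses its qubit with probability `1/2`, the level `2` being the flag. -/
def erasureMixture {N : ℕ} (ρ : MultiOp N 2) : MultiOp N 3 :=
  (1 / 2 ^ N : ℂ) • ∑ S : Finset (Fin N), padTwo S * reduced S ρ * (padTwo S)ᴴ

/-- The compression of a qutrit operator to the levels `0` and `1`. -/
def qubitBlock (M : Matrix (Fin 3) (Fin 3) ℂ) : Matrix (Fin 2) (Fin 2) ℂ :=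
  M.submatrix Fin.castSucc Fin.castSucc

/-- Twice the qubit operator which a qutrit measurement operator effectively measures when the
qubit is replaced by the flag `2` with probability `1/2`. -/
def erasureDual (M : Matrix (Fin 3) (Fin 3) ℂ) : Matrix (Fin 2) (Fin 2) ℂ :=
  qubitBlock M + M 2 2 • 1

section Erasure

variable {N : ℕ}

lemma padTwo_apply (S : Finset (Fin N)) (t : Fin N → Fin 3) (i : S → Fin 2) :
    padTwo S t i = if t = glue S (fun n => (i n).castSucc) (fun _ => 2) then 1 else 0 := rfl

lemma conjTranspose_padTwo_mul_tensor_mul_padTwo (S : Finset (Fin N))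
    (M : Fin N → Matrix (Fin 3) (Fin 3) ℂ) (l k : S → Fin 2) :
    ((padTwo S)ᴴ * tensor M * padTwo S) l k =
      (∏ n : S, qubitBlock (M n) (l n) (k n)) * ∏ n : (Sᶜ : Finset (Fin N)), M n 2 2 := by
  simp [mul_apply, padTwo_apply, tensor, prod_eq_prod_mul_prod_compl S, glue_apply_mem,
    glue_apply_compl, qubitBlock]

lemma trace_padTwo_reduced_mul_tensor (S : Finset (Fin N)) (ρ : MultiOp N 2)
    (M : Fin N → Matrix (Fin 3) (Fin 3) ℂ) :
    (padTwo S * reduced S ρ * (padTwo S)ᴴ * tensor M).trace = (ρ * tensor fun n =>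
      if n ∈ S then qubitBlock (M n) else M n 2 2 • 1).trace := by
  have hδ (m m' : (Sᶜ : Finset (Fin N)) → Fin 2) :
      ∏ n : (Sᶜ : Finset (Fin N)), (M n 2 2 • (1 : Matrix (Fin 2) (Fin 2) ℂ)) (m n) (m' n) =
        if m = m' then ∏ n : (Sᶜ : Finset (Fin N)), M n 2 2 else 0 := by
    simp_rw [Matrix.smul_apply, one_apply, smul_eq_mul, mul_ite, mul_one, mul_zero,
      Finset.prod_ite_zero, funext_iff, Finset.mem_univ, forall_const]
  have hprod (k l m m') : tensor (fun n => if n ∈ S then qubitBlock (M n) else M n 2 2 • 1)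
      (glue S l m') (glue S k m) = (∏ n : S, qubitBlock (M n) (l n) (k n)) *
        if m' = m then ∏ n : (Sᶜ : Finset (Fin N)), M n 2 2 else 0 := by
    rw [← hδ, tensor, of_apply, prod_eq_prod_mul_prod_compl S]
    congr 1 <;> refine Finset.prod_congr rfl fun n _ => ?_
    · rw [if_pos n.2, glue_apply_mem, glue_apply_mem]
    · rw [if_neg (Finset.mem_compl.1 n.2), glue_apply_compl, glue_apply_compl]
  rw [Matrix.mul_assoc, Matrix.mul_assoc, trace_mul_comm, Matrix.mul_assoc]
  simp only [trace, diag_apply, mul_apply (M := reduced S ρ), mul_apply (M := ρ),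
    conjTranspose_padTwo_mul_tensor_mul_padTwo, reduced_apply, sum_eq_sum_glue S, hprod]
  refine Finset.sum_congr rfl fun k _ => ?_
  rw [Finset.sum_comm]
  refine Finset.sum_congr rfl fun l _ => ?_
  simp [Finset.sum_mul]

lemma trace_erasureMixture_mul_tensor (ρ : MultiOp N 2) (M : Fin N → Matrix (Fin 3) (Fin 3) ℂ) :
    (erasureMixture ρ * tensor M).trace =
      1 / 2 ^ N * (ρ * tensor fun n => erasureDual (M n)).trace := by
  have hexpand : (tensor fun n => erasureDual (M n)) = ∑ S : Finset (Fin N),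
      tensor fun n => if n ∈ S then qubitBlock (M n) else M n 2 2 • 1 := by
    ext i j
    simp_rw [Matrix.sum_apply, tensor, of_apply, erasureDual, Matrix.add_apply, Fintype.prod_add]
    refine Finset.sum_congr rfl fun S _ => ?_
    rw [← Finset.prod_mul_prod_compl S]
    congr 1 <;> refine Finset.prod_congr rfl fun n hn => ?_
    · rw [if_pos hn]
    · rw [if_neg (Finset.mem_compl.1 hn)]
  rw [erasureMixture, smul_mul_assoc, trace_smul, smul_eq_mul, Finset.sum_mul, trace_sum, hexpand,
    Matrix.mul_sum, trace_sum]
  simp_rw [trace_padTwo_reduced_mul_tensor]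

lemma erasureDual_one : erasureDual 1 = (2 : ℂ) • 1 := by
  rw [erasureDual, qubitBlock, submatrix_one _ (Fin.castSucc_injective 2), one_apply_eq, one_smul,
    two_smul]

lemma trace_erasureMixture (ρ : MultiOp N 2) : (erasureMixture ρ).trace = ρ.trace := by
  have htwo : (tensor fun _ : Fin N => (2 : ℂ) • (1 : Matrix (Fin 2) (Fin 2) ℂ)) =
      (2 : ℂ) ^ N • 1 := by
    simp [tensor_smul, tensor_one]
  have h := trace_erasureMixture_mul_tensor ρ fun _ => 1
  simp_rw [tensor_one, mul_one, erasureDual_one, htwo] at h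
  rw [h, mul_smul_comm, mul_one, trace_smul, smul_eq_mul]
  field_simp

lemma isState_erasureMixture {ρ : MultiOp N 2} (hρ : IsState ρ) : IsState (erasureMixture ρ) :=
  ⟨(posSemidef_sum _ fun S _ => (reduced_posSemidef S hρ.1).mul_mul_conjTranspose_same _).smul
    (by simp), (trace_erasureMixture ρ).trans hρ.2⟩

end Erasure

/-! ### The pair state -/

/-- The Schmidt coefficients `cos θ`, `sin θ` of `|ψ_θ⟩`. -/
def schmidt (θ : ℝ) : Fin 2 → ℝ := ![Real.cos θ, Real.sin θ]

/-- The operator `∑ₛ λₛ |s⟩⟨s|`, `λ` being the Schmidt coefficients of `|ψ_θ⟩`. -/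
def schmidtOp (θ : ℝ) : Matrix (Fin 2) (Fin 2) ℂ := diagonal fun s => (schmidt θ s : ℂ)

/-- The operator on Bob's side to which the effect `Q` of Alice steers the isotropic operator
`α ∑ |ii⟩⟨jj| + (1 - α) 𝟙/2`. -/
def steered (α : ℝ) (Q : Matrix (Fin 2) (Fin 2) ℂ) : Matrix (Fin 2) (Fin 2) ℂ :=
  (α : ℂ) • Qᵀ + ((1 - α) / 2 * Q.trace) • 1

lemma rhoPair_posSemidef {α : ℝ} (hα : α ∈ Set.Icc (0 : ℝ) 1) (θ : ℝ) :
    (rhoPair α θ).PosSemidef := by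
  have h₀ : (0 : ℂ) ≤ α := by exact_mod_cast hα.1
  have h₁ : (0 : ℂ) ≤ 1 - α := by exact_mod_cast sub_nonneg.2 hα.2
  have h₂ : (0 : ℂ) ≤ 1 / 2 := by
    rw [Complex.le_def]
    norm_num
  exact ((ketbra_posSemidef _).smul h₀).add
    (((traceRight_posSemidef (ketbra_posSemidef _)).kronecker (PosSemidef.one.smul h₂)).smul h₁)

lemma rhoPair_apply (α θ : ℝ) (i s j t : Fin 2) :
    rhoPair α θ (i, s) (j, t) = schmidt θ i * schmidt θ j *
      (α * (if i = s ∧ j = t then 1 else 0) + if i = j ∧ s = t then (1 - α) / 2 else 0) := by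
  fin_cases i <;> fin_cases s <;> fin_cases j <;> fin_cases t <;>
    simp [rhoPair, ketbra, psi, traceRight, vecMulVec_apply, schmidt, -Complex.ofReal_cos,
      -Complex.ofReal_sin] <;> ring

lemma trace_rightBlock_rhoPair_mul (α θ : ℝ) (s t : Fin 2) (Q : Matrix (Fin 2) (Fin 2) ℂ) :
    (rightBlock (rhoPair α θ) s t * Q).trace =
      steered α (schmidtOp θ * Q * schmidtOp θ) s t := by
  fin_cases s <;> fin_cases t <;>
    simp [trace_fin_two, mul_apply, rightBlock, rhoPair_apply, steered, schmidtOp] <;> ring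

/-- The eigenvalues of Bob's reduced state. -/
def bobWeight (α θ : ℝ) (s : Fin 2) : ℝ := α * schmidt θ s ^ 2 + (1 - α) / 2

lemma schmidt_sq_add_sq (θ : ℝ) : schmidt θ 0 ^ 2 + schmidt θ 1 ^ 2 = 1 :=
  Real.cos_sq_add_sin_sq θ

lemma bobWeight_pos {α θ : ℝ} (hα : α ∈ Set.Icc (0 : ℝ) 1) (hc : Real.cos θ ≠ 0)
    (hs : Real.sin θ ≠ 0) (s : Fin 2) : 0 < bobWeight α θ s := by
  have hsq : 0 < schmidt θ s ^ 2 := by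
    fin_cases s
    exacts [sq_pos_of_ne_zero hc, sq_pos_of_ne_zero hs]
  rcases hα.1.eq_or_lt with rfl | h
  · norm_num [bobWeight]
  · have := mul_pos h hsq
    rw [bobWeight]
    linarith [hα.2]

lemma steered_schmidtOp_mul_self (α θ : ℝ) (s t : Fin 2) :
    steered α (schmidtOp θ * schmidtOp θ) s t = if s = t then (bobWeight α θ s : ℂ) else 0 := by
  have h : (schmidt θ 0 * schmidt θ 0 + schmidt θ 1 * schmidt θ 1 : ℂ) = 1 := by
    have := schmidt_sq_add_sq θ
    rw [sq, sq] at this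
    exact_mod_cast this
  rw [steered, schmidtOp, diagonal_mul_diagonal, trace_diagonal, Fin.sum_univ_two, h]
  by_cases hst : s = t
  · subst hst
    simp [bobWeight, sq]
  · simp [hst]

/-! ### The network state -/

section Network

variable {N : ℕ} {α θ : ℝ}

lemma trace_starNetwork_rhoPair_mul_tensor (M : Fin N → Matrix (Fin 2) (Fin 2) ℂ) :
    (starNetwork N (rhoPair α θ) * tensor M).trace =
      ∑ s, ∑ t, ∏ n, steered α (schmidtOp θ * M n * schmidtOp θ) s t := by
  simp_rw [starNetwork_eq_sum_tensor, Matrix.sum_mul, tensor_mul_tensor, trace_sum, trace_tensor,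
    trace_rightBlock_rhoPair_mul]

lemma trace_starNetwork_rhoPair (hN : N ≠ 0) :
    (starNetwork N (rhoPair α θ)).trace = ((∑ s, bobWeight α θ s ^ N : ℝ) : ℂ) := by
  have h := trace_starNetwork_rhoPair_mul_tensor (N := N) (α := α) (θ := θ) fun _ => 1
  rw [tensor_one, mul_one] at h
  simp [h, steered_schmidtOp_mul_self, hN]

lemma trace_rhoGME_mul_tensor (M : Fin N → Matrix (Fin 3) (Fin 3) ℂ) :
    (rhoGME N α θ * tensor M).trace = 1 / 2 ^ N * (starNetwork N (rhoPair α θ)).trace⁻¹ *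
      ∑ s, ∑ t, ∏ n, steered α (schmidtOp θ * erasureDual (M n) * schmidtOp θ) s t := by
  have h : rhoGME N α θ = erasureMixture (normalize (starNetwork N (rhoPair α θ))) := rfl
  rw [h, trace_erasureMixture_mul_tensor, normalize, smul_mul_assoc, trace_smul, smul_eq_mul,
    trace_starNetwork_rhoPair_mul_tensor, mul_assoc]

lemma sum_bobWeight_pow_pos (hα : α ∈ Set.Icc (0 : ℝ) 1) (hc : Real.cos θ ≠ 0)
    (hs : Real.sin θ ≠ 0) : 0 < ∑ s, bobWeight α θ s ^ N :=
  Finset.sum_pos (fun s _ => pow_pos (bobWeight_pos hα hc hs s) N) Finset.univ_nonempty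

lemma trace_starNetwork_rhoPair_ne_zero (hN : N ≠ 0) (hα : α ∈ Set.Icc (0 : ℝ) 1)
    (hc : Real.cos θ ≠ 0) (hs : Real.sin θ ≠ 0) : (starNetwork N (rhoPair α θ)).trace ≠ 0 := by
  rw [trace_starNetwork_rhoPair hN]
  exact_mod_cast (sum_bobWeight_pow_pos hα hc hs).ne'

lemma isState_rhoGME (hN : N ≠ 0) (hα : α ∈ Set.Icc (0 : ℝ) 1) (hc : Real.cos θ ≠ 0)
    (hs : Real.sin θ ≠ 0) : IsState (rhoGME N α θ) :=
  isState_erasureMixture (isState_normalize (starNetwork_posSemidef (rhoPair_posSemidef hα θ))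
    (trace_starNetwork_rhoPair_ne_zero hN hα hc hs))

end Network

/-! ### Local filtering -/

/-- Filtering an operator by `G_ε` at each party, without normalisation. -/
def filterAll {N : ℕ} (ε : ℝ) (ρ : MultiOp N 3) : MultiOp N 3 :=
  (tensor fun _ => filterOp ε) * ρ * (tensor fun _ => filterOp ε)

section Filter

variable {N : ℕ}

lemma conjTranspose_filterOp (ε : ℝ) : (filterOp ε)ᴴ = filterOp ε := by
  rw [filterOp, diagonal_conjTranspose]
  congr 1
  ext k
  fin_cases k <;> simp

lemma filterAll_posSemidef (ε : ℝ) {ρ : MultiOp N 3} (hρ : ρ.PosSemidef) :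
    (filterAll ε ρ).PosSemidef := by
  have h := hρ.mul_mul_conjTranspose_same (tensor fun _ : Fin N => filterOp ε)
  rwa [conjTranspose_tensor, conjTranspose_filterOp] at h

lemma isState_filtered {ε : ℝ} {ρ : MultiOp N 3} (hρ : ρ.PosSemidef)
    (h : (filterAll ε ρ).trace ≠ 0) : IsState (filtered ε ρ) :=
  isState_normalize (filterAll_posSemidef ε hρ) h

lemma trace_filtered_mul (ε : ℝ) (ρ A : MultiOp N 3) :
    (filtered ε ρ * A).trace = (filterAll ε ρ).trace⁻¹ * (filterAll ε ρ * A).trace := by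
  rw [filtered, normalize, smul_mul_assoc, trace_smul, smul_eq_mul, filterAll]

lemma trace_filterAll_mul_tensor (ε : ℝ) (ρ : MultiOp N 3)
    (M : Fin N → Matrix (Fin 3) (Fin 3) ℂ) :
    (filterAll ε ρ * tensor M).trace =
      (ρ * tensor fun n => filterOp ε * M n * filterOp ε).trace := by
  rw [filterAll, Matrix.mul_assoc, Matrix.mul_assoc, trace_mul_comm, Matrix.mul_assoc,
    ← tensor_mul_tensor, ← tensor_mul_tensor]

/-- `G_{tan θ}` turns both Schmidt coefficients of `|ψ_θ⟩` into `sin θ`. -/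
lemma schmidtOp_mul_erasureDual_filterOp {θ : ℝ} (hc : Real.cos θ ≠ 0)
    (M : Matrix (Fin 3) (Fin 3) ℂ) :
    schmidtOp θ * erasureDual (filterOp (Real.tan θ) * M * filterOp (Real.tan θ)) * schmidtOp θ =
      ((Real.sin θ ^ 2 : ℝ) : ℂ) • qubitBlock M := by
  have h : (Real.cos θ : ℂ) * (Real.tan θ : ℝ) = (Real.sin θ : ℝ) := by
    rw [mul_comm]
    exact_mod_cast Real.tan_mul_cos hc
  ext i j
  fin_cases i <;> fin_cases j <;>
    simp [schmidtOp, schmidt, erasureDual, qubitBlock, filterOp, diagonal_mul, mul_diagonal,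
      -Complex.ofReal_cos, -Complex.ofReal_sin, -Complex.ofReal_tan, ← h] <;> ring

lemma steered_smul (α : ℝ) (c : ℂ) (Q : Matrix (Fin 2) (Fin 2) ℂ) :
    steered α (c • Q) = c • steered α Q := by
  simp only [steered, transpose_smul, trace_smul, smul_eq_mul, smul_add, smul_smul]
  ring_nf

lemma sum_sum_steered_one_pow (hN : N ≠ 0) (α : ℝ) :
    ∑ s, ∑ t, steered α (1 : Matrix (Fin 2) (Fin 2) ℂ) s t ^ N = 2 := by
  have h : steered α 1 = 1 := by
    rw [steered, transpose_one, trace_one, ← add_smul]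
    simp
  simp [h, one_apply, ite_pow, hN]

variable {α θ : ℝ}

lemma trace_filterAll_rhoGME_mul_tensor (hc : Real.cos θ ≠ 0)
    (M : Fin N → Matrix (Fin 3) (Fin 3) ℂ) :
    (filterAll (Real.tan θ) (rhoGME N α θ) * tensor M).trace =
      1 / 2 ^ N * (starNetwork N (rhoPair α θ)).trace⁻¹ * ((Real.sin θ ^ 2 : ℝ) : ℂ) ^ N *
        ∑ s, ∑ t, ∏ n, steered α (qubitBlock (M n)) s t := by
  rw [trace_filterAll_mul_tensor, trace_rhoGME_mul_tensor]
  simp_rw [schmidtOp_mul_erasureDual_filterOp hc, steered_smul, Matrix.smul_apply, smul_eq_mul,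
    Finset.prod_mul_distrib, ← Finset.mul_sum, Finset.prod_const, Finset.card_univ,
    Fintype.card_fin, mul_assoc]

lemma qubitBlock_one : qubitBlock 1 = 1 := submatrix_one _ (Fin.castSucc_injective 2)

lemma trace_filterAll_rhoGME (hN : N ≠ 0) (hc : Real.cos θ ≠ 0) :
    (filterAll (Real.tan θ) (rhoGME N α θ)).trace =
      1 / 2 ^ N * (starNetwork N (rhoPair α θ)).trace⁻¹ * ((Real.sin θ ^ 2 : ℝ) : ℂ) ^ N * 2 := by
  have h := trace_filterAll_rhoGME_mul_tensor (N := N) (α := α) hc fun _ => 1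
  simpa only [tensor_one, mul_one, qubitBlock_one, Finset.prod_const, Finset.card_univ,
    Fintype.card_fin, sum_sum_steered_one_pow hN] using h

lemma trace_filterAll_rhoGME_ne_zero (hN : N ≠ 0) (hα : α ∈ Set.Icc (0 : ℝ) 1)
    (hc : Real.cos θ ≠ 0) (hs : Real.sin θ ≠ 0) :
    (filterAll (Real.tan θ) (rhoGME N α θ)).trace ≠ 0 := by
  have hZ := trace_starNetwork_rhoPair_ne_zero hN hα hc hs
  rw [trace_filterAll_rhoGME hN hc]
  exact mul_ne_zero (mul_ne_zero (mul_ne_zero (by simp) (inv_ne_zero hZ))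
    (pow_ne_zero N (Complex.ofReal_ne_zero.2 (pow_ne_zero 2 hs)))) two_ne_zero

/-- After filtering, the flag level is gone and the sources are isotropic, whatever `θ` was. -/
lemma trace_filtered_rhoGME_mul_tensor (hN : N ≠ 0) (hα : α ∈ Set.Icc (0 : ℝ) 1)
    (hc : Real.cos θ ≠ 0) (hs : Real.sin θ ≠ 0) (M : Fin N → Matrix (Fin 3) (Fin 3) ℂ) :
    (filtered (Real.tan θ) (rhoGME N α θ) * tensor M).trace =
      1 / 2 * ∑ s, ∑ t, ∏ n, steered α (qubitBlock (M n)) s t := by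
  have h0 := trace_filterAll_rhoGME_ne_zero hN hα hc hs
  rw [trace_filtered_mul, trace_filterAll_rhoGME_mul_tensor hc]
  rw [trace_filterAll_rhoGME hN hc] at h0 ⊢
  rw [mul_inv, mul_comm (_)⁻¹, mul_assoc, inv_mul_cancel_left₀ (left_ne_zero_of_mul h0), one_div]

end Filter

/-! ### The GHZ fidelity -/

section Fidelity

variable {N : ℕ}

lemma fidelityPure_ghz (ρ : MultiOp N 3) : fidelityPure ρ (ghz N) =
    1 / 2 * ∑ k : Fin 2, ∑ l : Fin 2, ρ (fun _ => k.castSucc) (fun _ => l.castSucc) := by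
  have hsqrt : ((Real.sqrt 2 : ℝ) : ℂ)⁻¹ * ((Real.sqrt 2 : ℝ) : ℂ)⁻¹ = 1 / 2 := by
    rw [← mul_inv, one_div, ← Complex.ofReal_mul, Real.mul_self_sqrt zero_le_two,
      Complex.ofReal_ofNat]
  have hstar (k : Fin N → Fin 3) : star (Pi.single k 1 : (Fin N → Fin 3) → ℂ) = Pi.single k 1 := by
    rw [← Pi.single_star, star_one]
  simp only [fidelityPure, ghz, mulVec_smul, mulVec_add, mulVec_single_one, star_smul, star_add,
    hstar, smul_dotProduct, dotProduct_smul, dotProduct_add, add_dotProduct,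
    single_one_dotProduct, col_apply, smul_eq_mul, one_div, Complex.ofReal_inv, star_inv₀,
    RCLike.star_def, Complex.conj_ofReal, Fin.sum_univ_two, Fin.castSucc_zero, Fin.castSucc_one]
  linear_combination (ρ (fun _ => 0) (fun _ => 0) + ρ (fun _ => 1) (fun _ => 0) +
    ρ (fun _ => 0) (fun _ => 1) + ρ (fun _ => 1) (fun _ => 1)) * hsqrt

lemma fidelityPure_ghz_eq_sum_trace (ρ : MultiOp N 3) : fidelityPure ρ (ghz N) =
    1 / 2 * ∑ k : Fin 2, ∑ l : Fin 2,
      (ρ * tensor (d := 3) fun _ => single l.castSucc k.castSucc 1).trace := by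
  simp_rw [fidelityPure_ghz, tensor_single, trace_mul_single, MulOpposite.op_one, one_smul]

lemma qubitBlock_single (k l : Fin 2) :
    qubitBlock (single k.castSucc l.castSucc 1) = single k l 1 := by
  ext i j
  simp [qubitBlock, single_apply]

lemma fidelityPure_filtered_rhoGME (hN : N ≠ 0) {α θ : ℝ} (hα : α ∈ Set.Icc (0 : ℝ) 1)
    (hc : Real.cos θ ≠ 0) (hs : Real.sin θ ≠ 0) :
    fidelityPure (filtered (Real.tan θ) (rhoGME N α θ)) (ghz N) =
      ((1 / 2 * (α ^ N + ((1 + α) / 2) ^ N + ((1 - α) / 2) ^ N) : ℝ) : ℂ) := by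
  have hdiag : (α : ℂ) + (1 - α) / 2 = (1 + α) / 2 := by ring
  simp_rw [fidelityPure_ghz_eq_sum_trace, trace_filtered_rhoGME_mul_tensor hN hα hc hs,
    qubitBlock_single]
  simp only [steered, transpose_single, trace_fin_two, Matrix.add_apply, Matrix.smul_apply,
    smul_eq_mul, mul_one, mul_zero, add_zero, zero_add, Finset.prod_const, Finset.card_univ,
    Fintype.card_fin, Fin.sum_univ_two, single_apply_same, one_apply_eq, single_apply_of_ne, ne_eq,
    zero_ne_one, one_ne_zero, not_false_eq_true, one_apply_ne, false_and, and_false, and_true, hN,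
    zero_pow, hdiag]
  push_cast
  ring

end Fidelity

/-! ### Genuine multipartite entanglement -/

lemma trace_ketbra {ι : Type} [Fintype ι] (v : ι → ℂ) :
    (ketbra v).trace = ((∑ i, ‖v i‖ ^ 2 : ℝ) : ℂ) := by
  simp [ketbra, trace_vecMulVec, dotProduct, Complex.mul_conj']

lemma fidelityPure_eq_trace_mul_ketbra {ι : Type} [Fintype ι] (ρ : Matrix ι ι ℂ) (v : ι → ℂ) :
    fidelityPure ρ v = (ρ * ketbra v).trace := by
  rw [fidelityPure, ketbra, mul_vecMulVec, trace_vecMulVec, dotProduct_comm]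

lemma norm_add_mul_sq_le (a b c d : ℂ) :
    ‖a * c + b * d‖ ^ 2 ≤ (‖a‖ ^ 2 + ‖b‖ ^ 2) * (‖c‖ ^ 2 + ‖d‖ ^ 2) := by
  have htri : ‖a * c + b * d‖ ≤ ‖a‖ * ‖c‖ + ‖b‖ * ‖d‖ :=
    (norm_add_le _ _).trans (by rw [norm_mul, norm_mul])
  calc ‖a * c + b * d‖ ^ 2 ≤ (‖a‖ * ‖c‖ + ‖b‖ * ‖d‖) ^ 2 := by gcongr
    _ ≤ (‖a‖ ^ 2 + ‖b‖ ^ 2) * (‖c‖ ^ 2 + ‖d‖ ^ 2) := by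
      nlinarith [sq_nonneg (‖a‖ * ‖d‖ - ‖b‖ * ‖c‖)]

lemma sq_add_sq_le_sum_const {κ : Type} [Fintype κ] [DecidableEq κ] [Nonempty κ] {d : ℕ}
    {k l : Fin d} (hkl : k ≠ l) (v : (κ → Fin d) → ℂ) :
    ‖v fun _ => k‖ ^ 2 + ‖v fun _ => l‖ ^ 2 ≤ ∑ i, ‖v i‖ ^ 2 := by
  have hne : (fun _ : κ => k) ≠ fun _ => l := fun h => hkl (congrFun h (Classical.arbitrary κ))
  rw [← Finset.sum_pair (f := fun i => ‖v i‖ ^ 2) hne]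
  exact Finset.sum_le_univ_sum_of_nonneg fun i => sq_nonneg _

section Biseparable

variable {N : ℕ}

lemma bipartiteVec_glue {d : ℕ} (b : Finset (Fin N)) (Φ : (b → Fin d) → ℂ)
    (Ψ : ((bᶜ : Finset (Fin N)) → Fin d) → ℂ) (k : b → Fin d)
    (m : (bᶜ : Finset (Fin N)) → Fin d) : bipartiteVec b Φ Ψ (glue b k m) = Φ k * Ψ m := by
  simp only [bipartiteVec, glue_apply_mem, glue_apply_compl]

lemma sum_norm_sq_bipartiteVec {d : ℕ} (b : Finset (Fin N)) (Φ : (b → Fin d) → ℂ)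
    (Ψ : ((bᶜ : Finset (Fin N)) → Fin d) → ℂ) :
    ∑ i, ‖bipartiteVec b Φ Ψ i‖ ^ 2 = (∑ k, ‖Φ k‖ ^ 2) * ∑ m, ‖Ψ m‖ ^ 2 := by
  simp_rw [sum_eq_sum_glue b, bipartiteVec_glue, norm_mul, mul_pow, Finset.sum_mul_sum]

lemma tensor_diagonal_mulVec_bipartiteVec {d : ℕ} (g : Fin d → ℂ) (b : Finset (Fin N))
    (Φ : (b → Fin d) → ℂ) (Ψ : ((bᶜ : Finset (Fin N)) → Fin d) → ℂ) :
    tensor (fun _ => diagonal g) *ᵥ bipartiteVec b Φ Ψ =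
      bipartiteVec b (fun i => (∏ n, g (i n)) * Φ i) (fun i => (∏ n, g (i n)) * Ψ i) := by
  have hdiag : tensor (fun _ : Fin N => diagonal g) = diagonal fun i => ∏ n, g (i n) := by
    ext i j
    simp_rw [tensor, of_apply, diagonal_apply, Finset.prod_ite_zero, funext_iff, Finset.mem_univ,
      forall_const]
  ext i
  rw [hdiag, mulVec_diagonal, prod_eq_prod_mul_prod_compl b]
  exact mul_mul_mul_comm _ _ _ _

/-- A vector which is a product across a bipartition has Schmidt rank one there, while both Schmidt
coefficients of the GHZ state are `1/√2`. -/
lemma two_mul_fidelityPure_ghz_bipartiteVec_le {b : Finset (Fin N)} (hb : b ∈ bipartitions N)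
    (Φ : (b → Fin 3) → ℂ) (Ψ : ((bᶜ : Finset (Fin N)) → Fin 3) → ℂ) :
    2 * fidelityPure (ketbra (bipartiteVec b Φ Ψ)) (ghz N) ≤
      (ketbra (bipartiteVec b Φ Ψ)).trace := by
  obtain ⟨hb₁, hb₂⟩ := (Finset.mem_filter.1 hb).2
  have : Nonempty b := hb₁.to_subtype
  have : Nonempty (bᶜ : Finset (Fin N)) := hb₂.to_subtype
  have hfid : 2 * fidelityPure (ketbra (bipartiteVec b Φ Ψ)) (ghz N) =
      ((‖(Φ fun _ => 0) * (Ψ fun _ => 0) + (Φ fun _ => 1) * (Ψ fun _ => 1)‖ ^ 2 : ℝ) : ℂ) := by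
    rw [fidelityPure_ghz, Complex.ofReal_pow, ← Complex.mul_conj']
    simp only [ketbra, vecMulVec_apply, bipartiteVec, Pi.star_apply, RCLike.star_def,
      Fin.sum_univ_two, Fin.castSucc_zero, Fin.castSucc_one, map_add]
    ring
  rw [hfid, trace_ketbra, Complex.real_le_real, sum_norm_sq_bipartiteVec]
  exact (norm_add_mul_sq_le _ _ _ _).trans (mul_le_mul (sq_add_sq_le_sum_const zero_ne_one Φ)
    (sq_add_sq_le_sum_const zero_ne_one Ψ) (by positivity) (by positivity))

lemma filterAll_ketbra (ε : ℝ) (v : (Fin N → Fin 3) → ℂ) :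
    filterAll ε (ketbra v) = ketbra ((tensor fun _ => filterOp ε) *ᵥ v) := by
  rw [filterAll, ketbra, mul_vecMulVec, vecMulVec_mul, ketbra, star_mulVec, conjTranspose_tensor,
    conjTranspose_filterOp]

/-- The entanglement witness `G_ε^{⊗N} (𝟙 - 2 |GHZ⟩⟨GHZ|) G_ε^{⊗N}`. -/
def ghzWitness (N : ℕ) (ε : ℝ) : MultiOp N 3 := filterAll ε (1 - (2 : ℂ) • ketbra (ghz N))

lemma trace_mul_ghzWitness (ε : ℝ) (ρ : MultiOp N 3) : (ρ * ghzWitness N ε).trace =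
    (filterAll ε ρ).trace - 2 * fidelityPure (filterAll ε ρ) (ghz N) := by
  have h : (ρ * ghzWitness N ε).trace =
      (filterAll ε ρ * (1 - (2 : ℂ) • ketbra (ghz N))).trace := by
    rw [ghzWitness, filterAll, filterAll, ← Matrix.mul_assoc, trace_mul_comm]
    simp only [Matrix.mul_assoc]
  rw [h, Matrix.mul_sub, mul_one, mul_smul_comm, trace_sub, trace_smul, smul_eq_mul,
    fidelityPure_eq_trace_mul_ketbra]

lemma trace_mul_ghzWitness_nonneg (ε : ℝ) {ρ : MultiOp N 3} (hρ : IsBiseparable ρ) :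
    0 ≤ (ρ * ghzWitness N ε).trace := by
  obtain ⟨k, p, q, Φ, Ψ, hp, -, hq, -, rfl⟩ := hρ
  simp only [Matrix.sum_mul, smul_mul_assoc, trace_sum, trace_smul, smul_eq_mul]
  refine Finset.sum_nonneg fun b hb => mul_nonneg (Complex.zero_le_real.2 (hp b hb))
    (Finset.sum_nonneg fun j _ => mul_nonneg (Complex.zero_le_real.2 ((hq b hb).1 j)) ?_)
  rw [trace_mul_ghzWitness, filterAll_ketbra, filterOp, tensor_diagonal_mulVec_bipartiteVec,
    sub_nonneg]
  exact two_mul_fidelityPure_ghz_bipartiteVec_le hb _ _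

lemma isGME_of_half_lt_fidelityPure_filtered {ε : ℝ} {ρ : MultiOp N 3} (hρ : IsState ρ)
    (h : 1 / 2 < fidelityPure (filtered ε ρ) (ghz N)) : IsGME ρ := by
  refine ⟨hρ, fun hsep => h.not_ge ?_⟩
  set t := (filterAll ε ρ).trace
  have ht : 0 ≤ t⁻¹ := inv_nonneg.2 (filterAll_posSemidef ε hρ.1).trace_nonneg
  have hW : 2 * fidelityPure (filterAll ε ρ) (ghz N) ≤ t :=
    sub_nonneg.1 (trace_mul_ghzWitness ε ρ ▸ trace_mul_ghzWitness_nonneg ε hsep)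
  calc fidelityPure (filtered ε ρ) (ghz N) = t⁻¹ * fidelityPure (filterAll ε ρ) (ghz N) := by
        simp_rw [fidelityPure_eq_trace_mul_ketbra, trace_filtered_mul, t]
    _ = 1 / 2 * (t⁻¹ * (2 * fidelityPure (filterAll ε ρ) (ghz N))) := by ring
    _ ≤ 1 / 2 * (t⁻¹ * t) := by gcongr
    _ ≤ 1 / 2 * 1 := by
      gcongr
      exact inv_mul_le_one
    _ = 1 / 2 := mul_one _

end Biseparable

/-! ### The Svetlichny inequality -/

lemma isResponse_le_one {I O : Type} [Fintype O] {P : I → O → ℝ} (hP : IsResponse P) (i : I)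
    (o : O) : P i o ≤ 1 :=
  (Finset.single_le_sum (fun o _ => (hP i).1 o) (Finset.mem_univ o)).trans_eq (hP i).2

lemma integrable_isResponse_mul_isResponse {L I J O O' : Type} [MeasurableSpace L] [Fintype O]
    [Fintype O'] {μ : Measure L} [IsFiniteMeasure μ] {P : L → I → O → ℝ} {Q : L → J → O' → ℝ}
    (hP : ∀ l, IsResponse (P l)) (hQ : ∀ l, IsResponse (Q l)) {i : I} {j : J} {o : O} {o' : O'}
    (hPm : Measurable fun l => P l i o) (hQm : Measurable fun l => Q l j o') :
    Integrable (fun l => P l i o * Q l j o') μ := by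
  refine Integrable.of_bound (C := 1) (hPm.mul hQm).aestronglyMeasurable (.of_forall fun l => ?_)
  have hP₀ := (hP l i).1 o
  have hQ₀ := (hQ l j).1 o'
  rw [Real.norm_of_nonneg (mul_nonneg hP₀ hQ₀)]
  exact mul_le_one₀ (isResponse_le_one (hP l) i o) hQ₀ (isResponse_le_one (hQ l) j o')

lemma sum_mul_le_of_isBilocal {N : ℕ} {X A : Type} [Fintype X] [Fintype A]
    {F : (Fin N → X) → (Fin N → A) → ℝ} {C : ℝ}
    (hF : ∀ b ∈ bipartitions N, ∀ (P : (b → X) → (b → A) → ℝ)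
      (Q : ((bᶜ : Finset (Fin N)) → X) → ((bᶜ : Finset (Fin N)) → A) → ℝ),
      IsResponse P → IsResponse Q → ∑ x : Fin N → X, ∑ a : Fin N → A, F x a *
        (P (fun n => x n) (fun n => a n) * Q (fun n => x n) (fun n => a n)) ≤ C)
    {p : (Fin N → X) → (Fin N → A) → ℝ} (hp : IsBilocal p) : ∑ x, ∑ a, F x a * p x a ≤ C := by
  obtain ⟨L, _, w, μ, P, Q, hw, hw₁, hμ, hPQ, hPm, hQm, hp⟩ := hp
  have hint : ∀ b ∈ bipartitions N, ∀ (x : Fin N → X) (a : Fin N → A), Integrable (fun l =>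
      F x a * (P b l (fun n => x n) (fun n => a n) * Q b l (fun n => x n) (fun n => a n)))
        (μ b) := fun b hb x a =>
    have := hμ b hb
    (integrable_isResponse_mul_isResponse (fun l => (hPQ b hb l).1) (fun l => (hPQ b hb l).2)
      (hPm b hb _ _) (hQm b hb _ _)).const_mul _
  have hsum : ∑ x, ∑ a, F x a * p x a = ∑ b ∈ bipartitions N, w b * ∫ l, ∑ x : Fin N → X,
      ∑ a : Fin N → A, F x a *
        (P b l (fun n => x n) (fun n => a n) * Q b l (fun n => x n) (fun n => a n)) ∂(μ b) := by
    simp_rw [hp, Finset.mul_sum, Finset.sum_comm (s := Finset.univ) (t := bipartitions N)]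
    refine Finset.sum_congr rfl fun b hb => ?_
    rw [integral_finsetSum _ fun x _ => integrable_finsetSum _ fun a _ => hint b hb x a,
      Finset.mul_sum]
    refine Finset.sum_congr rfl fun x _ => ?_
    rw [integral_finsetSum _ fun a _ => hint b hb x a, Finset.mul_sum]
    exact Finset.sum_congr rfl fun a _ => by rw [integral_const_mul, mul_left_comm]
  calc ∑ x, ∑ a, F x a * p x a ≤ ∑ b ∈ bipartitions N, w b * C := by
        rw [hsum]
        refine Finset.sum_le_sum fun b hb => mul_le_mul_of_nonneg_left ?_ (hw b hb)
        have := hμ b hb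
        refine (integral_mono (integrable_finsetSum _ fun x _ => integrable_finsetSum _ fun a _ =>
          hint b hb x a) (integrable_const C)
          fun l => hF b hb _ _ (hPQ b hb l).1 (hPQ b hb l).2).trans_eq ?_
        simp
    _ = C := by rw [← Finset.sum_mul, hw₁, one_mul]

section Phase

variable {κ : Type} [Fintype κ]

/-- The phase `i^{∑ₙ yₙ}` of a string of binary inputs. -/
def phase (y : κ → Fin 2) : ℂ := ∏ n, Complex.I ^ (y n : ℕ)

/-- The parity `(-1)^{∑ₙ aₙ}` of a string of bits. -/
def paritySign (a : κ → Fin 2) : ℝ := ∏ n, (-1) ^ (a n : ℕ)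

lemma I_pow_even (m : ℕ) : Complex.I ^ (2 * m) = ((-1 : ℝ) ^ m : ℝ) := by
  rw [pow_mul, Complex.I_sq]
  push_cast
  rfl

lemma I_pow_odd (m : ℕ) : Complex.I ^ (2 * m + 1) = ((-1 : ℝ) ^ m : ℝ) * Complex.I := by
  rw [pow_succ, I_pow_even]

lemma abs_re_I_pow (k : ℕ) : |(Complex.I ^ k).re| = (1 + (-1) ^ k) / 2 := by
  obtain ⟨m, rfl | rfl⟩ := k.even_or_odd'
  · rw [I_pow_even, Complex.ofReal_re, abs_neg_one_pow, (even_two_mul m).neg_one_pow]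
    norm_num
  · rw [I_pow_odd, Complex.re_ofReal_mul, Complex.I_re, (odd_two_mul_add_one m).neg_one_pow]
    norm_num

lemma abs_im_I_pow (k : ℕ) : |(Complex.I ^ k).im| = (1 - (-1) ^ k) / 2 := by
  obtain ⟨m, rfl | rfl⟩ := k.even_or_odd'
  · rw [I_pow_even, Complex.ofReal_im, (even_two_mul m).neg_one_pow]
    norm_num
  · rw [I_pow_odd, Complex.im_ofReal_mul, Complex.I_im, mul_one, abs_neg_one_pow,
      (odd_two_mul_add_one m).neg_one_pow]
    norm_num

lemma re_add_im_I_pow_sq (k : ℕ) : ((Complex.I ^ k).re + (Complex.I ^ k).im) ^ 2 = 1 := by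
  obtain ⟨m, rfl | rfl⟩ := k.even_or_odd'
  · rw [I_pow_even, Complex.ofReal_re, Complex.ofReal_im, add_zero, ← pow_mul, pow_mul',
      neg_one_sq, one_pow]
  · rw [I_pow_odd, Complex.re_ofReal_mul, Complex.im_ofReal_mul, Complex.I_re, Complex.I_im,
      mul_zero, zero_add, mul_one, ← pow_mul, pow_mul', neg_one_sq, one_pow]

lemma phase_eq_I_pow (y : κ → Fin 2) : phase y = Complex.I ^ ∑ n, (y n : ℕ) :=
  Finset.prod_pow_eq_pow_sum _ _ _

lemma paritySign_eq_pow (a : κ → Fin 2) : paritySign a = (-1) ^ ∑ n, (a n : ℕ) :=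
  Finset.prod_pow_eq_pow_sum _ _ _

lemma abs_paritySign (a : κ → Fin 2) : |paritySign a| = 1 := by
  rw [paritySign_eq_pow, abs_neg_one_pow]

variable [DecidableEq κ]

lemma sum_paritySign [Nonempty κ] : ∑ a : κ → Fin 2, paritySign a = 0 := by
  simp_rw [paritySign, ← Fintype.piFinset_univ,
    ← Finset.prod_univ_sum (fun _ => Finset.univ) fun _ (k : Fin 2) => (-1 : ℝ) ^ (k : ℕ)]
  simp

lemma sum_abs_re_phase [Nonempty κ] :
    ∑ y : κ → Fin 2, |(phase y).re| = 2 ^ Fintype.card κ / 2 := by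
  simp_rw [phase_eq_I_pow, abs_re_I_pow, ← paritySign_eq_pow, ← Finset.sum_div,
    Finset.sum_add_distrib, sum_paritySign]
  simp

lemma sum_abs_im_phase [Nonempty κ] :
    ∑ y : κ → Fin 2, |(phase y).im| = 2 ^ Fintype.card κ / 2 := by
  simp_rw [phase_eq_I_pow, abs_im_I_pow, ← paritySign_eq_pow, ← Finset.sum_div,
    Finset.sum_sub_distrib, sum_paritySign]
  simp

/-- The expected parity of the outputs of a response. -/
def parityMean (P : (κ → Fin 2) → (κ → Fin 2) → ℝ) (y : κ → Fin 2) : ℝ :=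
  ∑ a, paritySign a * P y a

lemma abs_parityMean_le {P : (κ → Fin 2) → (κ → Fin 2) → ℝ} (hP : IsResponse P)
    (y : κ → Fin 2) : |parityMean P y| ≤ 1 := by
  refine (Finset.abs_sum_le_sum_abs _ _).trans_eq ?_
  simp_rw [abs_mul, abs_paritySign, one_mul, abs_of_nonneg ((hP y).1 _), (hP y).2]

/-- The phases of the inputs, averaged with the expected parities of a response. -/
def parityPhase (P : (κ → Fin 2) → (κ → Fin 2) → ℝ) : ℂ := ∑ y, parityMean P y * phase y

lemma abs_re_parityPhase_le [Nonempty κ] {P : (κ → Fin 2) → (κ → Fin 2) → ℝ}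
    (hP : IsResponse P) : |(parityPhase P).re| ≤ 2 ^ Fintype.card κ / 2 := by
  simp_rw [parityPhase, Complex.re_sum, Complex.re_ofReal_mul, ← sum_abs_re_phase]
  refine (Finset.abs_sum_le_sum_abs _ _).trans (Finset.sum_le_sum fun y _ => ?_)
  rw [abs_mul]
  exact mul_le_of_le_one_left (abs_nonneg _) (abs_parityMean_le hP y)

lemma abs_im_parityPhase_le [Nonempty κ] {P : (κ → Fin 2) → (κ → Fin 2) → ℝ}
    (hP : IsResponse P) : |(parityPhase P).im| ≤ 2 ^ Fintype.card κ / 2 := by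
  simp_rw [parityPhase, Complex.im_sum, Complex.im_ofReal_mul, ← sum_abs_im_phase]
  refine (Finset.abs_sum_le_sum_abs _ _).trans (Finset.sum_le_sum fun y _ => ?_)
  rw [abs_mul]
  exact mul_le_of_le_one_left (abs_nonneg _) (abs_parityMean_le hP y)

end Phase

/-- The CHSH inequality, the two settings of a side being the real and the imaginary part. -/
lemma re_mul_add_im_mul_le {z w : ℂ} {m k : ℝ} (hzr : |z.re| ≤ m) (hzi : |z.im| ≤ m)
    (hwr : |w.re| ≤ k) (hwi : |w.im| ≤ k) : (z * w).re + (z * w).im ≤ 2 * (m * k) := by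
  have hm : 0 ≤ m := (abs_nonneg _).trans hzr
  have h₁ : z.re * (w.re + w.im) ≤ m * |w.re + w.im| :=
    (le_abs_self _).trans (by rw [abs_mul]; gcongr)
  have h₂ : z.im * (w.re - w.im) ≤ m * |w.re - w.im| :=
    (le_abs_self _).trans (by rw [abs_mul]; gcongr)
  have h₃ : |w.re + w.im| + |w.re - w.im| ≤ 2 * k := by
    rw [abs_le] at hwr hwi
    rcases abs_cases (w.re + w.im) with h | h <;> rcases abs_cases (w.re - w.im) with h' | h' <;>
      linarith
  rw [Complex.mul_re, Complex.mul_im]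
  linarith [mul_le_mul_of_nonneg_left h₃ hm]

section Svetlichny

variable {N : ℕ}

/-- The coefficients `±1` of the Svetlichny expression. -/
def svetSign (x : Fin N → Fin 2) : ℝ := (phase x).re + (phase x).im

lemma svetSign_sq (x : Fin N → Fin 2) : svetSign x ^ 2 = 1 := by
  rw [svetSign, phase_eq_I_pow, re_add_im_I_pow_sq]

lemma phase_glue (b : Finset (Fin N)) (y : b → Fin 2) (z : (bᶜ : Finset (Fin N)) → Fin 2) :
    phase (glue b y z) = phase y * phase z := by
  simp_rw [phase, prod_eq_prod_mul_prod_compl b, glue_apply_mem, glue_apply_compl]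

lemma paritySign_glue (b : Finset (Fin N)) (y : b → Fin 2)
    (z : (bᶜ : Finset (Fin N)) → Fin 2) :
    paritySign (glue b y z) = paritySign y * paritySign z := by
  simp_rw [paritySign, prod_eq_prod_mul_prod_compl b, glue_apply_mem, glue_apply_compl]

lemma sum_svetSign_mul_paritySign_mul (b : Finset (Fin N)) (P : (b → Fin 2) → (b → Fin 2) → ℝ)
    (Q : ((bᶜ : Finset (Fin N)) → Fin 2) → ((bᶜ : Finset (Fin N)) → Fin 2) → ℝ) :
    ∑ x : Fin N → Fin 2, ∑ a : Fin N → Fin 2, svetSign x * paritySign a *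
      (P (fun n => x n) (fun n => a n) * Q (fun n => x n) (fun n => a n)) =
      (parityPhase P * parityPhase Q).re + (parityPhase P * parityPhase Q).im := by
  have hmean (x : Fin N → Fin 2) : ∑ a : Fin N → Fin 2, svetSign x * paritySign a *
      (P (fun n => x n) (fun n => a n) * Q (fun n => x n) (fun n => a n)) =
      svetSign x * (parityMean P (fun n => x n) * parityMean Q (fun n => x n)) := by
    simp_rw [mul_assoc, ← Finset.mul_sum, sum_eq_sum_glue b, paritySign_glue, glue_apply_mem,
      glue_apply_compl, parityMean, Finset.sum_mul_sum, mul_mul_mul_comm]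
  have hphase : parityPhase P * parityPhase Q = ∑ y, ∑ z,
      ((parityMean P y * parityMean Q z : ℝ) : ℂ) * (phase y * phase z) := by
    simp_rw [parityPhase, Finset.sum_mul_sum, Complex.ofReal_mul, mul_mul_mul_comm]
  rw [hphase]
  simp_rw [hmean, sum_eq_sum_glue b, glue_apply_mem, glue_apply_compl, svetSign, phase_glue,
    Complex.re_sum, Complex.im_sum, Complex.re_ofReal_mul, Complex.im_ofReal_mul,
    ← Finset.sum_add_distrib, ← mul_add, mul_comm (_ + _)]

lemma svetlichny_le_of_isBilocal {p : (Fin N → Fin 2) → (Fin N → Fin 2) → ℝ}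
    (hp : IsBilocal p) : ∑ x, ∑ a, svetSign x * paritySign a * p x a ≤ 2 ^ N / 2 := by
  refine sum_mul_le_of_isBilocal (fun b hb P Q hP hQ => ?_) hp
  obtain ⟨hb₁, hb₂⟩ := (Finset.mem_filter.1 hb).2
  have : Nonempty b := hb₁.to_subtype
  have : Nonempty (bᶜ : Finset (Fin N)) := hb₂.to_subtype
  have hcard : Fintype.card b + Fintype.card (bᶜ : Finset (Fin N)) = N := by
    rw [Fintype.card_coe, Fintype.card_coe, Finset.card_add_card_compl, Fintype.card_fin]
  calc _ = (parityPhase P * parityPhase Q).re + (parityPhase P * parityPhase Q).im :=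
        sum_svetSign_mul_paritySign_mul b P Q
    _ ≤ 2 * (2 ^ Fintype.card b / 2 * (2 ^ Fintype.card (bᶜ : Finset (Fin N)) / 2)) :=
        re_mul_add_im_mul_le (abs_re_parityPhase_le hP) (abs_im_parityPhase_le hP)
          (abs_re_parityPhase_le hQ) (abs_im_parityPhase_le hQ)
    _ = 2 ^ (Fintype.card b + Fintype.card (bᶜ : Finset (Fin N))) / 2 := by
        rw [pow_add]
        ring
    _ = 2 ^ N / 2 := by rw [hcard]

end Svetlichny

section Violation

variable {N d : ℕ}

/-- The qutrit observable `|2⟩⟨2| + u |1⟩⟨0| + ū |0⟩⟨1|`, acting on the qubit levels as an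
equatorial spin observable. -/
def phaseObs (u : ℂ) : Matrix (Fin 3) (Fin 3) ℂ := !![0, star u, 0; u, 0, 0; 0, 0, 1]

lemma isHermitian_phaseObs (u : ℂ) : (phaseObs u).IsHermitian := by
  ext i j
  fin_cases i <;> fin_cases j <;> simp [phaseObs]

lemma phaseObs_mul_self {u : ℂ} (hu : ‖u‖ = 1) : phaseObs u * phaseObs u = 1 := by
  ext i j
  fin_cases i <;> fin_cases j <;>
    simp [phaseObs, Matrix.mul_apply, Fin.sum_univ_three, Complex.mul_conj', Complex.conj_mul', hu]

lemma posSemidef_half_one_add {O : Matrix (Fin d) (Fin d) ℂ} (hO : O.IsHermitian)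
    (hO₂ : O * O = 1) : ((1 / 2 : ℂ) • (1 + O)).PosSemidef := by
  have hproj : (1 / 2 : ℂ) • (1 + O) = ((1 / 2 : ℂ) • (1 + O))ᴴ * ((1 / 2 : ℂ) • (1 + O)) := by
    have hsq : (1 + O) * (1 + O) = (2 : ℂ) • (1 + O) := by
      rw [mul_add, add_mul, add_mul, hO₂, two_smul, mul_one, one_mul, mul_one, add_comm O 1]
    rw [conjTranspose_smul, conjTranspose_add, conjTranspose_one, hO.eq, smul_mul_smul_comm, hsq,
      smul_smul]
    norm_num
  rw [hproj]
  exact posSemidef_conjTranspose_mul_self _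

/-- The phase `i^x` of the observable measured on input `x`; the factor `e^{-iπ/4}` aligning the
quantum value with the Svetlichny coefficients is shared equally by the parties. -/
def svetPhase (N : ℕ) (x : Fin 2) : ℂ :=
  Complex.exp ((-(Real.pi / 4) / N : ℝ) * Complex.I) * Complex.I ^ (x : ℕ)

lemma norm_svetPhase (N : ℕ) (x : Fin 2) : ‖svetPhase N x‖ = 1 := by
  rw [svetPhase, norm_mul, Complex.norm_exp_ofReal_mul_I, norm_pow, Complex.norm_I, one_pow,
    one_mul]

lemma re_prod_svetPhase (hN : N ≠ 0) (x : Fin N → Fin 2) :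
    (∏ n, svetPhase N (x n)).re = svetSign x / √2 := by
  have hexp : Complex.exp ((-(Real.pi / 4) / N : ℝ) * Complex.I) ^ N =
      (1 - Complex.I) / (√2 : ℝ) := by
    have hsqrt : (√2 : ℂ) * (√2 : ℝ) = 2 := by
      exact_mod_cast Real.mul_self_sqrt zero_le_two
    have harg : (N : ℂ) * ((-(Real.pi / 4) / N : ℝ) * Complex.I) =
        (-(Real.pi / 4) : ℝ) * Complex.I := by
      push_cast
      field_simp
    rw [← Complex.exp_nat_mul, harg, Complex.exp_mul_I, ← Complex.ofReal_cos,
      ← Complex.ofReal_sin, Real.cos_neg, Real.sin_neg, Real.cos_pi_div_four,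
      Real.sin_pi_div_four, eq_div_iff (by simp)]
    push_cast
    linear_combination (1 - Complex.I) / 2 * hsqrt
  simp_rw [svetPhase, Finset.prod_mul_distrib, Finset.prod_const, Finset.card_univ,
    Fintype.card_fin, hexp]
  rw [div_mul_eq_mul_div, Complex.div_ofReal_re, sub_mul, one_mul, Complex.sub_re,
    Complex.I_mul_re, sub_neg_eq_add, svetSign, phase]

/-- The two-outcome measurement of the observable `phaseObs (svetPhase N x)`. -/
def svetMeas (N : ℕ) (x a : Fin 2) : Matrix (Fin 3) (Fin 3) ℂ :=
  (1 / 2 : ℂ) • (1 + (-1 : ℂ) ^ (a : ℕ) • phaseObs (svetPhase N x))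

lemma isPOVM_svetMeas (N : ℕ) : IsPOVM (svetMeas N) := by
  refine fun x => ⟨fun a => posSemidef_half_one_add ?_ ?_, ?_⟩
  · rw [IsHermitian, conjTranspose_smul, isHermitian_phaseObs, star_pow, star_neg, star_one]
  · rw [smul_mul_smul_comm, phaseObs_mul_self (norm_svetPhase N x), ← mul_pow, neg_mul_neg,
      one_mul, one_pow, one_smul]
  · simp only [Fin.sum_univ_two, svetMeas, Fin.val_zero, Fin.val_one, pow_zero, pow_one]
    module

lemma sum_neg_one_pow_smul_svetMeas (N : ℕ) (x : Fin 2) :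
    ∑ a : Fin 2, (-1 : ℂ) ^ (a : ℕ) • svetMeas N x a = phaseObs (svetPhase N x) := by
  simp only [Fin.sum_univ_two, svetMeas, Fin.val_zero, Fin.val_one, pow_zero, pow_one]
  module

lemma sum_paritySign_mul_born {X : Type} (ρ : MultiOp N d)
    (M : Fin N → X → Fin 2 → Matrix (Fin d) (Fin d) ℂ) (x : Fin N → X) :
    ∑ a, paritySign a * born ρ M x a =
      (ρ * tensor fun n => ∑ a : Fin 2, (-1 : ℂ) ^ (a : ℕ) • M n (x n) a).trace.re := by
  simp_rw [tensor_sum fun n (a : Fin 2) => (-1 : ℂ) ^ (a : ℕ) • M n (x n) a, tensor_smul,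
    Matrix.mul_sum, trace_sum, Matrix.mul_smul, trace_smul, smul_eq_mul, Complex.re_sum, born,
    ← Complex.re_ofReal_mul, paritySign]
  simp

lemma trace_filtered_rhoGME_mul_tensor_phaseObs (hN : N ≠ 0) {α θ : ℝ}
    (hα : α ∈ Set.Icc (0 : ℝ) 1) (hc : Real.cos θ ≠ 0) (hs : Real.sin θ ≠ 0) (u : Fin N → ℂ) :
    (filtered (Real.tan θ) (rhoGME N α θ) * tensor fun n => phaseObs (u n)).trace =
      α ^ N * (∏ n, u n).re := by
  have hblock (v : ℂ) : steered α (qubitBlock (phaseObs v)) = !![0, α * v; α * star v, 0] := by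
    ext i j
    fin_cases i <;> fin_cases j <;> simp [steered, qubitBlock, phaseObs, trace_fin_two]
  rw [trace_filtered_rhoGME_mul_tensor hN hα hc hs]
  simp_rw [hblock, Fin.sum_univ_two]
  simp only [of_apply, cons_val', cons_val_zero, cons_val_one, cons_val_fin_one,
    Finset.prod_const, Finset.card_univ, Fintype.card_fin, zero_pow hN, Finset.prod_mul_distrib,
    zero_add, add_zero, Complex.re_eq_add_conj, RCLike.star_def, map_prod]
  ring

lemma sum_svetSign_mul_born_filtered_rhoGME (hN : N ≠ 0) {α θ : ℝ}
    (hα : α ∈ Set.Icc (0 : ℝ) 1) (hc : Real.cos θ ≠ 0) (hs : Real.sin θ ≠ 0) :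
    ∑ x, ∑ a, svetSign x * paritySign a *
      born (filtered (Real.tan θ) (rhoGME N α θ)) (fun _ => svetMeas N) x a =
        2 ^ N * (α ^ N / √2) := by
  have hcorr (x : Fin N → Fin 2) : ∑ a, svetSign x * paritySign a *
      born (filtered (Real.tan θ) (rhoGME N α θ)) (fun _ => svetMeas N) x a = α ^ N / √2 := by
    simp_rw [mul_assoc, ← Finset.mul_sum, sum_paritySign_mul_born, sum_neg_one_pow_smul_svetMeas,
      trace_filtered_rhoGME_mul_tensor_phaseObs hN hα hc hs, ← Complex.ofReal_pow,
      Complex.re_ofReal_mul, Complex.ofReal_re, re_prod_svetPhase hN]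
    linear_combination α ^ N / √2 * svetSign_sq x
  simp [hcorr]

lemma not_isBilocal_born_filtered_rhoGME (hN : N ≠ 0) {α θ : ℝ} (hα : α ∈ Set.Icc (0 : ℝ) 1)
    (hαN : 3 / 4 ≤ α ^ N) (hc : Real.cos θ ≠ 0) (hs : Real.sin θ ≠ 0) :
    ¬ IsBilocal (born (filtered (Real.tan θ) (rhoGME N α θ)) fun _ => svetMeas N) := by
  intro hbilocal
  have hle := svetlichny_le_of_isBilocal hbilocal
  rw [sum_svetSign_mul_born_filtered_rhoGME hN hα hc hs, div_eq_mul_one_div (2 ^ N),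
    mul_le_mul_iff_right₀ (by positivity), div_le_div_iff₀ (by positivity) two_pos] at hle
  have hsqrt : √2 < 3 / 2 := by
    rw [Real.sqrt_lt' (by norm_num)]
    norm_num
  linarith

end Violation

/-! ### Sequential measurements -/

lemma exists_isProbabilityMeasure_integral_mul {L : Type*} [MeasurableSpace L] {μ : Measure L}
    {g : L → ℝ} (hg : Measurable g) (hg₀ : ∀ l, 0 ≤ g l) (hne : ∫ l, g l ∂μ ≠ 0) :
    ∃ ν : Measure L, IsProbabilityMeasure ν ∧
      ∀ f : L → ℝ, ∫ l, g l * f l ∂μ = (∫ l, g l ∂μ) * ∫ l, f l ∂ν := by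
  have hint : Integrable g μ := by_contra fun h => hne (integral_undef h)
  set c := ∫ l, g l ∂μ
  have hc₀ : 0 ≤ c := integral_nonneg hg₀
  have hcg (l : L) : 0 ≤ c⁻¹ * g l := mul_nonneg (inv_nonneg.2 hc₀) (hg₀ l)
  refine ⟨μ.withDensity fun l => (Real.toNNReal (c⁻¹ * g l) : ENNReal), ⟨?_⟩, fun f => ?_⟩
  · rw [withDensity_apply _ .univ, Measure.restrict_univ]
    change ∫⁻ l, ENNReal.ofReal (c⁻¹ * g l) ∂μ = 1
    rw [← ofReal_integral_eq_lintegral_ofReal (hint.const_mul _) (.of_forall hcg),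
      integral_const_mul, inv_mul_cancel₀ hne, ENNReal.ofReal_one]
  · rw [integral_withDensity_eq_integral_smul (hg.const_mul _).real_toNNReal,
      ← integral_const_mul]
    refine integral_congr_ae (.of_forall fun l => ?_)
    simp only [NNReal.smul_def, smul_eq_mul, Real.coe_toNNReal _ (hcg l)]
    field_simp

lemma exists_isProbabilityMeasure_integral_mul_of_integrable {L : Type*} [MeasurableSpace L]
    {μ : Measure L} [IsProbabilityMeasure μ] {g : L → ℝ} (hg : Measurable g)
    (hg₀ : ∀ l, 0 ≤ g l) (hint : Integrable g μ) :
    ∃ ν : Measure L, IsProbabilityMeasure ν ∧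
      ∀ f : L → ℝ, ∫ l, g l * f l ∂μ = (∫ l, g l ∂μ) * ∫ l, f l ∂ν := by
  rcases eq_or_ne (∫ l, g l ∂μ) 0 with hzero | hne
  · have hae : g =ᵐ[μ] 0 := (integral_eq_zero_iff_of_nonneg hg₀ hint).1 hzero
    refine ⟨μ, inferInstance, fun f => ?_⟩
    rw [hzero, zero_mul]
    exact integral_eq_zero_of_ae (hae.mono fun l hl => by simp [hl])
  · exact exists_isProbabilityMeasure_integral_mul hg hg₀ hne

section PostSelection

variable {N : ℕ} {Z C X A : Type} [Fintype C] [Fintype A]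

lemma sum_integral_isResponse_mul {L : Type} [MeasurableSpace L] (ν : Measure L)
    [IsProbabilityMeasure ν] {b : Finset (Fin N)} {P : L → (b → X) → (b → A) → ℝ}
    {Q : L → ((bᶜ : Finset (Fin N)) → X) → ((bᶜ : Finset (Fin N)) → A) → ℝ}
    (hP : ∀ l, IsResponse (P l)) (hQ : ∀ l, IsResponse (Q l))
    (hPm : ∀ x a, Measurable fun l => P l x a) (hQm : ∀ x a, Measurable fun l => Q l x a)
    (x : Fin N → X) :
    ∑ a : Fin N → A, ∫ l, P l (fun n => x n) (fun n => a n) *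
      Q l (fun n => x n) (fun n => a n) ∂ν = 1 := by
  rw [← integral_finsetSum _ fun a _ =>
    integrable_isResponse_mul_isResponse hP hQ (hPm _ _) (hQm _ _)]
  simp_rw [sum_eq_sum_glue b, glue_apply_mem, glue_apply_compl, ← Finset.sum_mul_sum,
    (hP _ _).2, (hQ _ _).2]
  simp

/-- In a time-ordered model the first outcomes do not depend on the later inputs, so conditioning
on them only reweights the hidden variables. -/
lemma isBilocal_postselect [Nonempty X]
    {p : (Fin N → Z) → (Fin N → C) → (Fin N → X) → (Fin N → A) → ℝ} (hp : IsSeqBilocal p)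
    (z : Fin N → Z) (c : Fin N → C) {t : ℝ} (ht : t ≠ 0) (hsum : ∀ x, ∑ a, p z c x a = t) :
    IsBilocal fun x a => p z c x a / t := by
  obtain ⟨L, _, w, μ, P₁, P₂, Q₁, Q₂, hw, -, hμ, hPQ₁, hP₂, hQ₂, hP₁m, hP₂m, hQ₁m, hQ₂m, hp⟩ := hp
  let g (b : Finset (Fin N)) (l : L) : ℝ :=
    P₁ b l (fun n => z n) (fun n => c n) * Q₁ b l (fun n => z n) (fun n => c n)
  have hg₀ : ∀ b ∈ bipartitions N, ∀ l, 0 ≤ g b l := fun b hb l =>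
    mul_nonneg (((hPQ₁ b hb l).1 _).1 _) (((hPQ₁ b hb l).2 _).1 _)
  have hg₁ : ∀ b ∈ bipartitions N, ∀ l, g b l ≤ 1 := fun b hb l =>
    mul_le_one₀ (isResponse_le_one (hPQ₁ b hb l).1 _ _) (((hPQ₁ b hb l).2 _).1 _)
      (isResponse_le_one (hPQ₁ b hb l).2 _ _)
  have hgm : ∀ b ∈ bipartitions N, Measurable (g b) := fun b hb =>
    (hP₁m b hb _ _).mul (hQ₁m b hb _ _)
  choose! ν hν hνg using fun b hb =>
    have := hμ b hb
    exists_isProbabilityMeasure_integral_mul_of_integrable (μ := μ b) (hgm b hb) (hg₀ b hb)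
      (.of_mem_Icc 0 1 (hgm b hb).aemeasurable (.of_forall fun l => ⟨hg₀ b hb l, hg₁ b hb l⟩))
  have hp' (x : Fin N → X) (a : Fin N → A) : p z c x a =
      ∑ b ∈ bipartitions N, w b * (∫ l, g b l ∂(μ b)) * ∫ l,
        P₂ b l (fun n => z n) (fun n => c n) (fun n => x n) (fun n => a n) *
        Q₂ b l (fun n => z n) (fun n => c n) (fun n => x n) (fun n => a n) ∂(ν b) := by
    rw [hp]
    refine Finset.sum_congr rfl fun b hb => ?_
    rw [mul_assoc, ← hνg b hb]
    simp_rw [g, mul_mul_mul_comm]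
  have hwt : ∑ b ∈ bipartitions N, w b * ∫ l, g b l ∂(μ b) = t := by
    rw [← hsum fun _ => Classical.arbitrary X]
    simp_rw [hp']
    rw [Finset.sum_comm]
    refine Finset.sum_congr rfl fun b hb => ?_
    have := hν b hb
    rw [← Finset.mul_sum, sum_integral_isResponse_mul (ν b) (fun l => hP₂ b hb l _ _)
      (fun l => hQ₂ b hb l _ _) (hP₂m b hb _ _) (hQ₂m b hb _ _) (fun _ => Classical.arbitrary X),
      mul_one]
  have hwg₀ : ∀ b ∈ bipartitions N, 0 ≤ w b * ∫ l, g b l ∂(μ b) := fun b hb =>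
    mul_nonneg (hw b hb) (integral_nonneg (hg₀ b hb))
  refine ⟨L, ‹_›, fun b => w b * (∫ l, g b l ∂(μ b)) / t, ν,
    fun b l => P₂ b l (fun n => z n) (fun n => c n),
    fun b l => Q₂ b l (fun n => z n) (fun n => c n),
    fun b hb => div_nonneg (hwg₀ b hb) (hwt ▸ Finset.sum_nonneg hwg₀),
    by rw [← Finset.sum_div, hwt, div_self ht], hν, fun b hb l => ⟨hP₂ b hb l _ _, hQ₂ b hb l _ _⟩,
    fun b hb => hP₂m b hb _ _, fun b hb => hQ₂m b hb _ _, fun x a => ?_⟩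
  simp_rw [hp', Finset.sum_div, mul_div_right_comm]

end PostSelection

section Filter

variable {N : ℕ}

/-- The filter `G_ε`, completed to a measurement by its failure outcome. -/
def filterInstrument (ε : ℝ) (c : Fin 2) : Matrix (Fin 3) (Fin 3) ℂ :=
  ![filterOp ε, diagonal ![((√(1 - ε ^ 2) : ℝ) : ℂ), 0, 1]] c

lemma isInstrument_filterInstrument {ε : ℝ} (hε : ε ^ 2 ≤ 1) :
    IsInstrument fun _ : Fin 1 => filterInstrument ε := by
  intro z
  have hsqrt : ((√(1 - ε ^ 2) : ℝ) : ℂ) * (√(1 - ε ^ 2) : ℝ) = 1 - (ε : ℂ) ^ 2 := by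
    exact_mod_cast Real.mul_self_sqrt (sub_nonneg.2 hε)
  simp only [Fin.sum_univ_two, filterInstrument, cons_val_zero, cons_val_one,
    conjTranspose_filterOp, diagonal_conjTranspose]
  rw [filterOp, diagonal_mul_diagonal, diagonal_mul_diagonal, diagonal_add, ← diagonal_one]
  congr 1
  ext k
  fin_cases k <;> simp [hsqrt, ← sq]

lemma sum_born {d : ℕ} {X A : Type} [Fintype A] (ρ : MultiOp N d)
    {M : Fin N → X → A → Matrix (Fin d) (Fin d) ℂ} (hM : ∀ n, IsPOVM (M n)) (x : Fin N → X) :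
    ∑ a, born ρ M x a = ρ.trace.re := by
  simp_rw [born, ← Complex.re_sum, ← trace_sum, ← Matrix.mul_sum,
    ← tensor_sum fun n => M n (x n), (hM _ _).2, tensor_one, Matrix.mul_one]

lemma ofReal_re_trace_filterAll (ε : ℝ) {ρ : MultiOp N 3} (hρ : ρ.PosSemidef) :
    ((filterAll ε ρ).trace.re : ℂ) = (filterAll ε ρ).trace :=
  (Complex.eq_re_of_ofReal_le (r := 0) (filterAll_posSemidef ε hρ).trace_nonneg).symm

lemma born_filtered {X A : Type} {ε : ℝ} {ρ : MultiOp N 3} (hρ : ρ.PosSemidef)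
    (M : Fin N → X → A → Matrix (Fin 3) (Fin 3) ℂ) :
    born (filtered ε ρ) M =
      fun x a => born (filterAll ε ρ) M x a / (filterAll ε ρ).trace.re := by
  ext x a
  rw [born, trace_filtered_mul, ← ofReal_re_trace_filterAll ε hρ, ← Complex.ofReal_inv,
    Complex.re_ofReal_mul, Complex.ofReal_re, ← div_eq_inv_mul, born]

/-- The first measurement of each party is the filter, and all successes are postselected. -/
lemma isSeqGMNL_of_not_isBilocal_born_filtered {ε : ℝ} (hε : ε ^ 2 ≤ 1) {ρ : MultiOp N 3}
    (hρ : ρ.PosSemidef) (h₀ : (filterAll ε ρ).trace ≠ 0) {m k : ℕ} [NeZero m]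
    {M : Fin N → Fin m → Fin k → Matrix (Fin 3) (Fin 3) ℂ} (hM : ∀ n, IsPOVM (M n))
    (h : ¬ IsBilocal (born (filtered ε ρ) M)) : IsSeqGMNL ρ := by
  refine ⟨1, 2, m, k, fun _ _ => filterInstrument ε, M,
    fun _ => isInstrument_filterInstrument hε, hM, fun hseq => h ?_⟩
  have hsucc (x : Fin N → Fin m) (a : Fin N → Fin k) :
      seqBorn ρ (fun _ (_ : Fin 1) => filterInstrument ε) M 0 0 x a =
        born (filterAll ε ρ) M x a := by
    simp [seqBorn, filterInstrument, conjTranspose_tensor, conjTranspose_filterOp, filterAll, born]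
  have htrace : (filterAll ε ρ).trace.re ≠ 0 := fun hre => h₀ <| by
    rw [← ofReal_re_trace_filterAll ε hρ, hre, Complex.ofReal_zero]
  have hpost := isBilocal_postselect hseq 0 0 htrace fun x => by simp_rw [hsucc, sum_born _ hM]
  rw [born_filtered hρ]
  simpa only [hsucc] using hpost

end Filter

/-! ### Gaussian integrals -/

lemma integral_complex_radial (f : ℝ → ℝ) :
    ∫ z : ℂ, f ‖z‖ = 2 * Real.pi * ∫ r in Set.Ioi 0, r * f r := by
  rw [integral_fun_norm_addHaar volume f]
  simp only [Complex.finrank_real_complex, Complex.volume_ball, Measure.real, ENNReal.ofReal_one,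
    one_pow, one_mul, ENNReal.coe_toReal, NNReal.coe_real_pi, Nat.add_one_sub_one, pow_one,
    smul_eq_mul, nsmul_eq_mul, Nat.cast_ofNat]
  ring

lemma integral_mul_exp_neg_sq_Ioi (a : ℝ) (ha : 0 ≤ a) :
    ∫ r in Set.Ioi a, r * Real.exp (-r ^ 2) = Real.exp (-a ^ 2) / 2 := by
  have hderiv (r : ℝ) :
      HasDerivAt (fun r => -Real.exp (-r ^ 2) / 2) (r * Real.exp (-r ^ 2)) r := by
    refine ((hasDerivAt_pow 2 r).fun_neg.exp.fun_neg.div_const 2).congr_deriv ?_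
    simp only [Nat.cast_ofNat, Nat.add_one_sub_one, pow_one]
    ring
  have hlim : Tendsto (fun r : ℝ => -Real.exp (-r ^ 2) / 2) atTop (𝓝 0) := by
    simpa using ((Real.tendsto_exp_neg_atTop_nhds_zero.comp
      (tendsto_pow_atTop two_ne_zero)).neg.div_const 2)
  rw [integral_Ioi_of_hasDerivAt_of_nonneg' (fun r _ => hderiv r)
    (fun r hr => mul_nonneg (ha.trans hr.out.le) (Real.exp_pos _).le) hlim]
  ring

lemma integral_exp_neg_norm_sq_of_le {R : ℝ} (hR : 0 ≤ R) :
    ∫ z : ℂ, (if R ≤ ‖z‖ ^ 2 then Real.exp (-‖z‖ ^ 2) else 0) = Real.pi * Real.exp (-R) := by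
  rw [integral_complex_radial fun r => if R ≤ r ^ 2 then Real.exp (-r ^ 2) else 0]
  have htail : ∫ r in Set.Ioi 0, r * (if R ≤ r ^ 2 then Real.exp (-r ^ 2) else 0) =
      ∫ r in Set.Ioi √R, r * Real.exp (-r ^ 2) := by
    rw [← integral_Ici_eq_integral_Ioi, ← integral_Ici_eq_integral_Ioi,
      ← integral_indicator measurableSet_Ici, ← integral_indicator measurableSet_Ici]
    congr 1
    ext r
    by_cases hr : 0 ≤ r
    · by_cases hRr : R ≤ r ^ 2 <;> simp [Set.indicator, hr, hRr, Real.sqrt_le_left hr]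
    · simp [Set.indicator, hr, ((not_le.1 hr).trans_le (Real.sqrt_nonneg R)).not_ge]
  rw [htail, integral_mul_exp_neg_sq_Ioi _ (Real.sqrt_nonneg R), Real.sq_sqrt hR]
  ring

lemma integral_norm_sq_mul_exp {b : ℝ} (hb : 0 < b) :
    ∫ z : ℂ, ‖z‖ ^ 2 * Real.exp (-(b * ‖z‖ ^ 2)) = Real.pi / b ^ 2 := by
  have h := Complex.integral_rpow_mul_exp_neg_mul_rpow (p := 2) (q := 2) (b := b) (by norm_num)
    (by norm_num) hb
  simp only [Real.rpow_two, neg_mul] at h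
  rw [h]
  norm_num [Real.rpow_neg hb.le]
  rfl

lemma integrable_exp_neg_norm_sq : Integrable fun z : ℂ => Real.exp (-‖z‖ ^ 2) := by
  refine by_contra fun h => Real.pi_ne_zero ?_
  have hint := integral_exp_neg_norm_sq_of_le le_rfl
  simp only [sq_nonneg, ↓reduceIte, neg_zero, Real.exp_zero, mul_one] at hint
  rw [← hint, integral_undef h]

lemma integrable_norm_sq_mul_exp :
    Integrable fun z : ℂ => ‖z‖ ^ 2 * Real.exp (-‖z‖ ^ 2) := by
  refine by_contra fun h => Real.pi_ne_zero ?_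
  have hint := integral_norm_sq_mul_exp one_pos
  simp only [one_mul, one_pow, div_one] at hint
  rw [← hint, integral_undef h]

/-! ### Gaussian vectors in `ℂ²` -/

/-- The density of a standard complex Gaussian vector. -/
def gaussWeight (ψ : Fin 2 → ℂ) : ℝ := Real.exp (-(‖ψ 0‖ ^ 2 + ‖ψ 1‖ ^ 2)) / Real.pi ^ 2

/-- The matrix elements of the operator `|ψ⟩⟨ψ|`, weighted by the Gaussian density. -/
def hidden (s t : Fin 2) (ψ : Fin 2 → ℂ) : ℂ := (gaussWeight ψ : ℂ) * (ψ s * star (ψ t))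

/-- The average of `f ψ |ψ⟩⟨ψ|` over a Gaussian vector `ψ`: the operator prepared by the local
hidden state model in which the response to the hidden vector `ψ` is `f ψ`. -/
def hiddenAvg (f : (Fin 2 → ℂ) → ℝ) : Matrix (Fin 2) (Fin 2) ℂ :=
  of fun s t => ∫ ψ, (f ψ : ℂ) * hidden s t ψ

/-- The indicator of `κ |ψ_i|² ≤ |ψ_j|²`, a cap of the Bloch sphere. -/
def cap (κ : ℝ) (i j : Fin 2) (ψ : Fin 2 → ℂ) : ℝ :=
  if κ * ‖ψ i‖ ^ 2 ≤ ‖ψ j‖ ^ 2 then 1 else 0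

lemma gaussWeight_nonneg (ψ : Fin 2 → ℂ) : 0 ≤ gaussWeight ψ := by
  unfold gaussWeight
  positivity

lemma continuous_gaussWeight : Continuous gaussWeight := by
  unfold gaussWeight
  fun_prop

lemma continuous_hidden (s t : Fin 2) : Continuous (hidden s t) := by
  unfold hidden
  have := continuous_gaussWeight
  fun_prop

lemma hidden_self (s : Fin 2) (ψ : Fin 2 → ℂ) :
    hidden s s ψ = ((gaussWeight ψ * ‖ψ s‖ ^ 2 : ℝ) : ℂ) := by
  simp [hidden, Complex.mul_conj']

lemma measurable_cap (κ : ℝ) (i j : Fin 2) : Measurable (cap κ i j) :=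
  .ite (measurableSet_le (by fun_prop) (by fun_prop)) measurable_const measurable_const

lemma cap_mem_Icc (κ : ℝ) (i j : Fin 2) (ψ : Fin 2 → ℂ) : cap κ i j ψ ∈ Set.Icc 0 1 := by
  unfold cap
  split_ifs <;> simp

lemma integral_prod_cap {κ : ℝ} (hκ : 0 ≤ κ) :
    ∫ q : ℂ × ℂ, ‖q.1‖ ^ 2 * Real.exp (-‖q.1‖ ^ 2) *
      (if κ * ‖q.1‖ ^ 2 ≤ ‖q.2‖ ^ 2 then Real.exp (-‖q.2‖ ^ 2) else 0) =
      Real.pi ^ 2 / (1 + κ) ^ 2 := by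
  have hint : Integrable fun q : ℂ × ℂ => ‖q.1‖ ^ 2 * Real.exp (-‖q.1‖ ^ 2) *
      (if κ * ‖q.1‖ ^ 2 ≤ ‖q.2‖ ^ 2 then Real.exp (-‖q.2‖ ^ 2) else 0) := by
    refine ((integrable_norm_sq_mul_exp.mul_prod integrable_exp_neg_norm_sq).indicator
      (s := {q : ℂ × ℂ | κ * ‖q.1‖ ^ 2 ≤ ‖q.2‖ ^ 2})
      (measurableSet_le (by fun_prop) (by fun_prop))).congr (.of_forall fun q => ?_)
    by_cases h : κ * ‖q.1‖ ^ 2 ≤ ‖q.2‖ ^ 2 <;> simp [Set.indicator, h]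
  have hinner (u : ℂ) : ∫ v : ℂ, ‖u‖ ^ 2 * Real.exp (-‖u‖ ^ 2) *
      (if κ * ‖u‖ ^ 2 ≤ ‖v‖ ^ 2 then Real.exp (-‖v‖ ^ 2) else 0) =
      Real.pi * (‖u‖ ^ 2 * Real.exp (-((1 + κ) * ‖u‖ ^ 2))) := by
    rw [integral_const_mul, integral_exp_neg_norm_sq_of_le (by positivity), add_mul, neg_add,
      Real.exp_add, one_mul]
    ring
  rw [Measure.volume_eq_prod, integral_prod _ hint]
  simp_rw [hinner]
  rw [integral_const_mul, integral_norm_sq_mul_exp (by positivity)]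
  ring

lemma integral_cap {κ : ℝ} (hκ : 0 ≤ κ) {i j : Fin 2} (hij : i ≠ j) :
    ∫ ψ, cap κ i j ψ * (gaussWeight ψ * ‖ψ i‖ ^ 2) = 1 / (1 + κ) ^ 2 := by
  let F (u v : ℂ) : ℝ := (if κ * ‖u‖ ^ 2 ≤ ‖v‖ ^ 2 then 1 else 0) *
    (Real.exp (-(‖u‖ ^ 2 + ‖v‖ ^ 2)) / Real.pi ^ 2 * ‖u‖ ^ 2)
  have hF : ∫ q : ℂ × ℂ, F q.1 q.2 = 1 / (1 + κ) ^ 2 := by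
    have hfactor (q : ℂ × ℂ) : F q.1 q.2 = (Real.pi ^ 2)⁻¹ * (‖q.1‖ ^ 2 * Real.exp (-‖q.1‖ ^ 2) *
        (if κ * ‖q.1‖ ^ 2 ≤ ‖q.2‖ ^ 2 then Real.exp (-‖q.2‖ ^ 2) else 0)) := by
      simp only [F, neg_add, Real.exp_add]
      split_ifs <;> ring
    simp_rw [hfactor]
    rw [integral_const_mul, integral_prod_cap hκ]
    have := Real.pi_ne_zero
    field_simp
  have hpair (G : ℂ × ℂ → ℝ) : ∫ ψ : Fin 2 → ℂ, G (ψ 0, ψ 1) = ∫ q, G q :=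
    (volume_preserving_finTwoArrow ℂ).integral_comp' G
  rw [← hF]
  fin_cases i <;> fin_cases j <;>
    simp only [Fin.zero_eta, Fin.mk_one, ne_eq, not_true_eq_false] at hij
  · exact hpair fun q => F q.1 q.2
  · rw [Measure.volume_eq_prod, ← integral_prod_swap fun q : ℂ × ℂ => F q.1 q.2,
      ← Measure.volume_eq_prod, ← hpair fun q => F q.swap.1 q.swap.2]
    simp [F, cap, gaussWeight, add_comm]

lemma ae_mul_norm_sq_ne (κ : ℝ) : ∀ᵐ ψ : Fin 2 → ℂ, κ * ‖ψ 0‖ ^ 2 ≠ ‖ψ 1‖ ^ 2 := by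
  have hmeas : MeasurableSet {q : ℂ × ℂ | κ * ‖q.1‖ ^ 2 = ‖q.2‖ ^ 2} :=
    measurableSet_eq_fun (by fun_prop) (by fun_prop)
  have hprod : ∀ᵐ q : ℂ × ℂ, κ * ‖q.1‖ ^ 2 ≠ ‖q.2‖ ^ 2 := by
    rw [ae_iff]
    simp only [ne_eq, not_not]
    rw [Measure.volume_eq_prod, Measure.measure_prod_null hmeas]
    refine .of_forall fun u => measure_mono_null (fun v hv => ?_)
      (Measure.addHaar_sphere volume (0 : ℂ) √(κ * ‖u‖ ^ 2))
    rw [mem_sphere_zero_iff_norm, show κ * ‖u‖ ^ 2 = ‖v‖ ^ 2 from hv,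
      Real.sqrt_sq (norm_nonneg v)]
  exact (volume_preserving_finTwoArrow ℂ).quasiMeasurePreserving.ae hprod

lemma cap_eq_one_sub_cap {κ : ℝ} (hκ : 0 < κ) : cap κ 0 1 =ᵐ[volume] 1 - cap κ⁻¹ 1 0 := by
  filter_upwards [ae_mul_norm_sq_ne κ] with ψ hψ
  simp only [cap, Pi.sub_apply, Pi.one_apply, inv_mul_le_iff₀ hκ]
  rcases lt_or_gt_of_ne hψ with h | h <;> simp [h.le, h.not_ge]

lemma integral_gaussWeight_mul_norm_sq (s : Fin 2) :
    ∫ ψ, gaussWeight ψ * ‖ψ s‖ ^ 2 = 1 := by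
  obtain ⟨t, hst⟩ := exists_ne s
  simpa [cap] using integral_cap le_rfl hst.symm

lemma integrable_gaussWeight_mul_norm_sq (s : Fin 2) :
    Integrable fun ψ => gaussWeight ψ * ‖ψ s‖ ^ 2 :=
  by_contra fun h => one_ne_zero <|
    (integral_gaussWeight_mul_norm_sq s).symm.trans (integral_undef h)

lemma integral_cap_zero_one_mul_norm_sq_one {κ : ℝ} (hκ : 0 < κ) :
    ∫ ψ, cap κ 0 1 ψ * (gaussWeight ψ * ‖ψ 1‖ ^ 2) = 1 - 1 / (1 + κ⁻¹) ^ 2 := by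
  have hint : Integrable fun ψ => cap κ⁻¹ 1 0 ψ * (gaussWeight ψ * ‖ψ 1‖ ^ 2) :=
    (integrable_gaussWeight_mul_norm_sq 1).bdd_mul (c := 1)
      (measurable_cap _ 1 0).aestronglyMeasurable (.of_forall fun ψ => by
        rw [Real.norm_of_nonneg (cap_mem_Icc _ 1 0 ψ).1]; exact (cap_mem_Icc _ 1 0 ψ).2)
  calc ∫ ψ, cap κ 0 1 ψ * (gaussWeight ψ * ‖ψ 1‖ ^ 2)
      = ∫ ψ, (gaussWeight ψ * ‖ψ 1‖ ^ 2 - cap κ⁻¹ 1 0 ψ * (gaussWeight ψ * ‖ψ 1‖ ^ 2)) :=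
        integral_congr_ae <| (cap_eq_one_sub_cap hκ).mono fun ψ hψ => by
          simp only [hψ, Pi.sub_apply, Pi.one_apply, sub_mul, one_mul]
    _ = 1 - 1 / (1 + κ⁻¹) ^ 2 := by
        rw [integral_sub (integrable_gaussWeight_mul_norm_sq 1) hint,
          integral_gaussWeight_mul_norm_sq, integral_cap (inv_nonneg.2 hκ.le) one_ne_zero]

lemma integrable_hidden (s t : Fin 2) : Integrable (hidden s t) := by
  refine ((integrable_gaussWeight_mul_norm_sq s).add (integrable_gaussWeight_mul_norm_sq t)).mono'
    (continuous_hidden s t).aestronglyMeasurable (.of_forall fun ψ => ?_)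
  simp only [hidden, norm_mul, norm_star, Complex.norm_real, Pi.add_apply, ← mul_add,
    Real.norm_of_nonneg (gaussWeight_nonneg ψ)]
  gcongr
  · exact gaussWeight_nonneg ψ
  · nlinarith [sq_nonneg (‖ψ s‖ - ‖ψ t‖), sq_nonneg ‖ψ s‖, sq_nonneg ‖ψ t‖]

lemma integrable_mul_hidden {f : (Fin 2 → ℂ) → ℝ} (hf : Measurable f) {K : ℝ}
    (hK : ∀ ψ, f ψ ∈ Set.Icc 0 K) (s t : Fin 2) :
    Integrable fun ψ => (f ψ : ℂ) * hidden s t ψ :=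
  (integrable_hidden s t).bdd_mul (c := K)
    (Complex.measurable_ofReal.comp hf).aestronglyMeasurable
    (.of_forall fun ψ => by simpa [abs_of_nonneg (hK ψ).1] using (hK ψ).2)

lemma hiddenAvg_apply_self (f : (Fin 2 → ℂ) → ℝ) (s : Fin 2) :
    hiddenAvg f s s = ((∫ ψ, f ψ * (gaussWeight ψ * ‖ψ s‖ ^ 2) : ℝ) : ℂ) := by
  rw [hiddenAvg, of_apply, ← integral_complex_ofReal]
  simp only [hidden_self, Complex.ofReal_mul]

lemma measurePreserving_unitary (U : unitaryGroup (Fin 2) ℂ) :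
    MeasurePreserving (fun ψ : Fin 2 → ℂ => U.1 *ᵥ ψ) volume volume := by
  let f : (Fin 2 → ℂ) →ₗ[ℝ] (Fin 2 → ℂ) := (Matrix.toLin' U.1).restrictScalars ℝ
  have hU : ‖U.1.det‖ = 1 := CStarRing.norm_of_mem_unitary (det_of_mem_unitary U.2)
  have hdet : LinearMap.det f = 1 := by
    rw [LinearMap.det_restrictScalars, LinearMap.det_toLin', Algebra.norm_complex_apply,
      Complex.normSq_eq_norm_sq, hU, one_pow]
  have hf : Measurable f := f.continuous_of_finiteDimensional.measurable
  refine ⟨hf, ?_⟩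
  change Measure.map f volume = volume
  rw [Measure.map_linearMap_addHaar_eq_smul_addHaar volume (by rw [hdet]; exact one_ne_zero), hdet]
  simp

lemma star_mulVec_unitary_mulVec (U : unitaryGroup (Fin 2) ℂ) (ψ : Fin 2 → ℂ) :
    star U.1 *ᵥ U.1 *ᵥ ψ = ψ := by
  rw [mulVec_mulVec, (mem_unitaryGroup_iff').1 U.2, one_mulVec]

lemma integral_comp_unitary (U : unitaryGroup (Fin 2) ℂ) (F : (Fin 2 → ℂ) → ℂ) :
    ∫ ψ, F (U.1 *ᵥ ψ) = ∫ ψ, F ψ :=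
  (measurePreserving_unitary U).integral_comp (Continuous.measurableEmbedding (by fun_prop)
    (Function.LeftInverse.injective (star_mulVec_unitary_mulVec U))) F

lemma gaussWeight_unitary (U : unitaryGroup (Fin 2) ℂ) (ψ : Fin 2 → ℂ) :
    gaussWeight (U.1 *ᵥ ψ) = gaussWeight ψ := by
  have hnorm (φ : Fin 2 → ℂ) : star φ ⬝ᵥ φ = ((‖φ 0‖ ^ 2 + ‖φ 1‖ ^ 2 : ℝ) : ℂ) := by
    simp [dotProduct, Fin.sum_univ_two, Complex.conj_mul']
  have hU : star (U.1 *ᵥ ψ) ⬝ᵥ (U.1 *ᵥ ψ) = star ψ ⬝ᵥ ψ := by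
    rw [star_mulVec, ← dotProduct_mulVec, ← star_eq_conjTranspose, star_mulVec_unitary_mulVec]
  rw [hnorm, hnorm] at hU
  simp only [gaussWeight, Complex.ofReal_injective hU]

lemma hidden_mulVec (U : unitaryGroup (Fin 2) ℂ) (s t : Fin 2) (ψ : Fin 2 → ℂ) :
    hidden s t (U.1 *ᵥ ψ) = ∑ k, ∑ l, U.1 s k * star (U.1 t l) * hidden k l ψ := by
  simp only [hidden, gaussWeight_unitary, mulVec, dotProduct, star_sum, star_mul]
  rw [Finset.sum_mul_sum]
  simp only [Finset.mul_sum]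
  exact Finset.sum_congr rfl fun k _ => Finset.sum_congr rfl fun l _ => by ring

lemma hiddenAvg_comp_star_unitary (U : unitaryGroup (Fin 2) ℂ) {P : (Fin 2 → ℂ) → ℝ}
    (hP : Measurable P) (hP₁ : ∀ ψ, P ψ ∈ Set.Icc 0 1) :
    hiddenAvg (fun ψ => P (star U.1 *ᵥ ψ)) = U.1 * hiddenAvg P * star U.1 := by
  ext s t
  have hint (k l : Fin 2) : Integrable fun ψ =>
      U.1 s k * star (U.1 t l) * ((P ψ : ℂ) * hidden k l ψ) :=
    (integrable_mul_hidden hP hP₁ k l).const_mul _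
  simp only [hiddenAvg, of_apply, Matrix.mul_assoc]
  rw [← integral_comp_unitary U]
  simp only [star_mulVec_unitary_mulVec, hidden_mulVec, Finset.mul_sum,
    mul_left_comm (P _ : ℂ)]
  rw [integral_finsetSum _ fun k _ => integrable_finsetSum _ fun l _ => hint k l,
    Matrix.mul_apply]
  refine Finset.sum_congr rfl fun k _ => ?_
  rw [integral_finsetSum _ fun l _ => hint k l, Matrix.mul_apply, Finset.mul_sum]
  refine Finset.sum_congr rfl fun l _ => ?_
  rw [integral_const_mul, star_apply, of_apply]
  ring

/-- The symmetry `ψ₀ ↦ -ψ₀` reverses the sign of the off-diagonal elements. -/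
lemma hiddenAvg_apply_ne {f : (Fin 2 → ℂ) → ℝ} (hf : ∀ ψ, f ![-ψ 0, ψ 1] = f ψ) {s t : Fin 2}
    (hst : s ≠ t) : hiddenAvg f s t = 0 := by
  have hD : diagonal ![(-1 : ℂ), 1] ∈ unitaryGroup (Fin 2) ℂ := by
    rw [mem_unitaryGroup_iff, star_eq_conjTranspose, diagonal_conjTranspose,
      diagonal_mul_diagonal, ← diagonal_one]
    congr 1
    ext k
    fin_cases k <;> simp
  have hflip (ψ : Fin 2 → ℂ) : diagonal ![(-1 : ℂ), 1] *ᵥ ψ = ![-ψ 0, ψ 1] := by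
    ext k
    fin_cases k <;> simp [mulVec_diagonal]
  have hneg (ψ : Fin 2 → ℂ) : hidden s t ![-ψ 0, ψ 1] = -hidden s t ψ := by
    fin_cases s <;> fin_cases t <;> simp [hidden, gaussWeight] at hst ⊢
  have h := integral_comp_unitary ⟨_, hD⟩ fun ψ => (f ψ : ℂ) * hidden s t ψ
  simp only [hflip, hf, hneg, mul_neg, integral_neg] at h
  exact self_eq_neg.1 h.symm

lemma integral_hidden (s t : Fin 2) : ∫ ψ, hidden s t ψ = (1 : Matrix (Fin 2) (Fin 2) ℂ) s t := by
  have havg : ∫ ψ, hidden s t ψ = hiddenAvg (fun _ => 1) s t := by simp [hiddenAvg]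
  rw [havg]
  rcases eq_or_ne s t with rfl | hst
  · simp [hiddenAvg_apply_self, integral_gaussWeight_mul_norm_sq]
  · rw [hiddenAvg_apply_ne (fun _ => rfl) hst, one_apply_ne hst]

/-! ### Operators with a local hidden state response -/

lemma hiddenAvg_const_add_mul {P : (Fin 2 → ℂ) → ℝ} (hP : Measurable P)
    (hP₁ : ∀ ψ, P ψ ∈ Set.Icc 0 1) (x y : ℝ) :
    hiddenAvg (fun ψ => x + y * P ψ) = (x : ℂ) • 1 + (y : ℂ) • hiddenAvg P := by
  ext s t
  simp only [hiddenAvg, of_apply, Matrix.add_apply, Matrix.smul_apply, smul_eq_mul,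
    Complex.ofReal_add, Complex.ofReal_mul, add_mul, mul_assoc]
  rw [integral_add ((integrable_hidden s t).const_mul _)
    ((integrable_mul_hidden hP hP₁ s t).const_mul _), integral_const_mul,
    integral_const_mul, integral_hidden]

lemma hiddenAvg_cap {c : ℝ} (hc : c ∈ Set.Ioo 0 1) :
    hiddenAvg (cap (c⁻¹ - 1) 0 1) =
      diagonal ![((c ^ 2 : ℝ) : ℂ), ((c * (2 - c) : ℝ) : ℂ)] := by
  have hκ : 0 < c⁻¹ - 1 := sub_pos.2 ((one_lt_inv₀ hc.1).2 hc.2)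
  have hc₁ : 1 - c ≠ 0 := (sub_pos.2 hc.2).ne'
  have hc₀ : c ≠ 0 := hc.1.ne'
  ext s t
  rcases eq_or_ne s t with rfl | hst
  · rw [hiddenAvg_apply_self, diagonal_apply_eq]
    fin_cases s
    · rw [Fin.zero_eta, cons_val_zero, integral_cap hκ.le zero_ne_one]
      simp
    · have hinv : 1 + (c⁻¹ - 1)⁻¹ = (1 - c)⁻¹ := by field_simp; ring
      simp only [Fin.mk_one, cons_val_one, cons_val_zero]
      rw [integral_cap_zero_one_mul_norm_sq_one hκ, hinv]
      congr 1
      field_simp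
      ring
  · rw [diagonal_apply_ne _ hst]
    exact hiddenAvg_apply_ne (fun ψ => by simp [cap]) hst

lemma exists_hiddenAvg_eq_of_cap {c x y : ℝ} (hc : c ∈ Set.Ioo 0 1) (hx : x ∈ Set.Icc 0 1)
    (hxy : x + y ∈ Set.Icc 0 1) {e : Fin 2 → ℝ} (he₀ : x + y * c ^ 2 = e 0)
    (he₁ : x + y * (c * (2 - c)) = e 1) :
    ∃ P : (Fin 2 → ℂ) → ℝ, Measurable P ∧ (∀ ψ, P ψ ∈ Set.Icc 0 1) ∧
      hiddenAvg P = diagonal fun k => (e k : ℂ) := by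
  refine ⟨fun ψ => x + y * cap (c⁻¹ - 1) 0 1 ψ,
    ((measurable_cap _ 0 1).const_mul y).const_add x, fun ψ => ?_, ?_⟩
  · simp only [cap]
    split_ifs
    · simpa using hxy
    · simpa using hx
  · rw [hiddenAvg_const_add_mul (measurable_cap _ 0 1) (cap_mem_Icc _ 0 1), hiddenAvg_cap hc]
    ext s t
    fin_cases s <;> fin_cases t <;> simp [← he₀, ← he₁]

lemma exists_hiddenAvg_eq_diagonal {e : Fin 2 → ℝ} (h₀ : 0 ≤ e 0 + e 1) (h₂ : e 0 + e 1 ≤ 2)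
    (h : |e 0 - e 1| ≤ (e 0 + e 1) * (2 - (e 0 + e 1)) / 2) :
    ∃ P : (Fin 2 → ℂ) → ℝ, Measurable P ∧ (∀ ψ, P ψ ∈ Set.Icc 0 1) ∧
      hiddenAvg P = diagonal fun k => (e k : ℂ) := by
  set τ := e 0 + e 1
  rcases eq_or_lt_of_le (show 0 ≤ τ * (2 - τ) / 2 by nlinarith) with hz | hz
  · have he : e 0 = e 1 := sub_eq_zero.1 (abs_nonpos_iff.1 (hz ▸ h))
    exact exists_hiddenAvg_eq_of_cap (c := 1 / 2) (x := τ / 2) (y := 0) (by norm_num)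
      ⟨by linarith, by linarith⟩ ⟨by linarith, by linarith⟩ (by linarith) (by linarith)
  obtain ⟨hτ₀, hτ₂⟩ : 0 < τ ∧ τ < 2 := by
    constructor <;> by_contra! hτ' <;> nlinarith
  obtain ⟨k, ⟨hk₀, hk₁⟩, hk⟩ : ∃ k ∈ Set.Icc (0 : ℝ) 1, k * (τ * (2 - τ) / 2) = |e 0 - e 1| :=
    ⟨|e 0 - e 1| / (τ * (2 - τ) / 2), ⟨by positivity, (div_le_one hz).2 h⟩,
      div_mul_cancel₀ _ hz.ne'⟩
  rcases le_total (e 0) (e 1) with hle | hle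
  · rw [abs_of_nonpos (sub_nonpos.2 hle)] at hk
    refine exists_hiddenAvg_eq_of_cap (c := τ / 2) (x := (1 - k) * (τ / 2)) (y := k)
      ⟨by linarith, by linarith⟩ ⟨?_, ?_⟩ ⟨?_, ?_⟩ ?_ ?_ <;> nlinarith
  · rw [abs_of_nonneg (sub_nonneg.2 hle)] at hk
    refine exists_hiddenAvg_eq_of_cap (c := 1 - τ / 2) (x := k + (1 - k) * (τ / 2)) (y := -k)
      ⟨by linarith, by linarith⟩ ⟨?_, ?_⟩ ⟨?_, ?_⟩ ?_ ?_ <;> nlinarith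

/-- The discriminant `τ ^ 2 - 4 det A` is the square of the difference of the eigenvalues. -/
lemma exists_hiddenAvg_eq {A : Matrix (Fin 2) (Fin 2) ℂ} (hA : A.IsHermitian) {τ : ℝ}
    (hτ : A.trace = τ) (h₀ : 0 ≤ τ) (h₂ : τ ≤ 2)
    (h : τ ^ 2 - 4 * A.det.re ≤ (τ * (2 - τ) / 2) ^ 2) :
    ∃ P : (Fin 2 → ℂ) → ℝ, Measurable P ∧ (∀ ψ, P ψ ∈ Set.Icc 0 1) ∧ hiddenAvg P = A := by
  set e := hA.eigenvalues with he
  have htrace : e 0 + e 1 = τ := by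
    have := hA.trace_eq_sum_eigenvalues
    rw [hτ, Fin.sum_univ_two] at this
    simpa [he] using (congrArg Complex.re this).symm
  have hdet : A.det.re = e 0 * e 1 := by
    rw [hA.det_eq_prod_eigenvalues, Fin.prod_univ_two]
    simp [he]
  have hdiff : |e 0 - e 1| ≤ τ * (2 - τ) / 2 := by
    refine abs_le_of_sq_le_sq (le_trans (le_of_eq ?_) h)
      (by linarith [mul_nonneg h₀ (sub_nonneg.2 h₂)])
    rw [hdet, ← htrace]
    ring
  rw [← htrace] at h₀ h₂ hdiff
  obtain ⟨P, hP, hP₁, hPe⟩ := exists_hiddenAvg_eq_diagonal h₀ h₂ hdiff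
  let U := hA.eigenvectorUnitary
  refine ⟨fun ψ => P (star U.1 *ᵥ ψ), hP.comp (by fun_prop), fun ψ => hP₁ _, ?_⟩
  rw [hiddenAvg_comp_star_unitary U hP hP₁, hPe]
  exact (hA.spectral_theorem.trans (Unitary.conjStarAlgAut_apply ..)).symm

/-! ### Unsteerability of the pair state -/

/-- The action of `Q ↦ ρ_B^{-1/2} Tr_A[(Q ⊗ 𝟙) ρ_{α,θ}] ρ_B^{-1/2}` on qubit operators, with
`C = cos 2θ`, sends `(𝟙 + x Z) / 2` to `((1 + κ x) 𝟙 + t x Z) / 2`; this is the coefficient `κ`. -/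
def whitenedBias (α C : ℝ) : ℝ := C * (1 - α ^ 2) / (1 - α ^ 2 * C ^ 2)

/-- The coefficient `t` in the formula `(𝟙 + x Z) / 2 ↦ ((1 + κ x) 𝟙 + t x Z) / 2` explained at
`whitenedBias`. -/
def whitenedSlope (α C : ℝ) : ℝ := α * (1 - C ^ 2) / (1 - α ^ 2 * C ^ 2)

section PolynomialInequalities

variable {α C : ℝ}

lemma one_sub_sq_mul_sq_pos (hα : α ∈ Set.Ioo (0 : ℝ) 1) (hC : C ∈ Set.Ico (0 : ℝ) 1) :
    0 < 1 - α ^ 2 * C ^ 2 := by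
  have h : α * C < 1 := mul_lt_one_of_nonneg_of_lt_one_left hα.1.le hα.2 hC.2.le
  have h₀ : 0 ≤ α * C := mul_nonneg hα.1.le hC.1
  nlinarith

lemma whitenedSlope_nonneg (hα : α ∈ Set.Ioo (0 : ℝ) 1) (hC : C ∈ Set.Ico (0 : ℝ) 1) :
    0 ≤ whitenedSlope α C :=
  div_nonneg (mul_nonneg hα.1.le (by nlinarith [hC.1, hC.2])) (one_sub_sq_mul_sq_pos hα hC).le

lemma whitenedBias_mem_Icc (hα : α ∈ Set.Ioo (0 : ℝ) 1) (hC : C ∈ Set.Ico (0 : ℝ) 1) :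
    whitenedBias α C ∈ Set.Icc 0 1 := by
  have hD := one_sub_sq_mul_sq_pos hα hC
  refine ⟨div_nonneg (mul_nonneg hC.1 (by nlinarith [hα.1, hα.2])) hD.le, ?_⟩
  rw [whitenedBias, div_le_one hD]
  nlinarith [mul_nonneg (sub_nonneg.2 hC.2.le) (add_nonneg zero_le_one
    (mul_nonneg (sq_nonneg α) hC.1))]

lemma whitenedBias_add_whitenedSlope (h : α * C ∈ Set.Ioo (-1 : ℝ) 1) :
    whitenedBias α C + whitenedSlope α C = (C + α) / (1 + α * C) := by
  have hplus : 1 + α * C ≠ 0 := by linarith [h.1]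
  have hminus : 1 - α * C ≠ 0 := by linarith [h.2]
  have hfactor : 1 - α ^ 2 * C ^ 2 = (1 + α * C) * (1 - α * C) := by ring
  rw [whitenedBias, whitenedSlope, hfactor, ← add_div,
    div_eq_div_iff (mul_ne_zero hplus hminus) hplus]
  ring

lemma whitenedBias_sub_whitenedSlope (h : α * C ∈ Set.Ioo (-1 : ℝ) 1) :
    whitenedBias α C - whitenedSlope α C = (C - α) / (1 - α * C) := by
  have hplus : 1 + α * C ≠ 0 := by linarith [h.1]
  have hminus : 1 - α * C ≠ 0 := by linarith [h.2]
  have hfactor : 1 - α ^ 2 * C ^ 2 = (1 + α * C) * (1 - α * C) := by ring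
  rw [whitenedBias, whitenedSlope, hfactor, ← sub_div,
    div_eq_div_iff (mul_ne_zero hplus hminus) hminus]
  ring

lemma one_sub_whitenedBias_sq (hα : α ∈ Set.Ioo (0 : ℝ) 1) (hC : C ∈ Set.Ico (0 : ℝ) 1) :
    1 - whitenedBias α C ^ 2 =
      (1 - C ^ 2) * (1 - α ^ 4 * C ^ 2) / (1 - α ^ 2 * C ^ 2) ^ 2 := by
  have hD := (one_sub_sq_mul_sq_pos hα hC).ne'
  rw [whitenedBias, div_pow, eq_div_iff (pow_ne_zero 2 hD), sub_mul,
    div_mul_cancel₀ _ (pow_ne_zero 2 hD)]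
  ring

lemma whitenedSlope_le (hα : α ∈ Set.Ioo (0 : ℝ) 1) (hC : C ∈ Set.Ico (0 : ℝ) 1)
    (h : 2 * α - 1 ≤ (2 - α) * α ^ 3 * C ^ 2) :
    whitenedSlope α C ≤ (1 - whitenedBias α C ^ 2) / 2 := by
  have hD := one_sub_sq_mul_sq_pos hα hC
  have hC₁ : 0 ≤ 1 - C ^ 2 := by nlinarith [hC.1, hC.2]
  rw [one_sub_whitenedBias_sq hα hC, whitenedSlope, div_div,
    div_le_div_iff₀ hD (by positivity)]
  have hkey : 2 * α * (1 - α ^ 2 * C ^ 2) ≤ 1 - α ^ 4 * C ^ 2 := by linarith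
  nlinarith [mul_le_mul_of_nonneg_left hkey (mul_nonneg hC₁ hD.le)]

lemma one_sub_sq_le_of_unsteerable (hα : 19 / 20 ≤ α) (hα₁ : α < 1)
    (h : 2 * α - 1 ≤ (2 - α) * α ^ 3 * C ^ 2) : 1 - C ^ 2 ≤ (1 - α) ^ 2 * (1 + α) := by
  have : 0 < α := by linarith
  have hcube : (19 / 20 : ℝ) ^ 3 ≤ α ^ 3 := pow_le_pow_left₀ (by norm_num) hα 3
  have hcoeff : 1 - α ≤ (2 - α) * α ^ 3 := by nlinarith
  have hpos : 0 < (2 - α) * α ^ 3 := mul_pos (by linarith) (by positivity)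
  refine le_of_mul_le_mul_left ?_ hpos
  calc (2 - α) * α ^ 3 * (1 - C ^ 2) ≤ (1 - α) * ((1 - α) ^ 2 * (1 + α)) := by linarith
    _ ≤ (2 - α) * α ^ 3 * ((1 - α) ^ 2 * (1 + α)) :=
      mul_le_mul_of_nonneg_right hcoeff (by positivity)

lemma one_sub_whitenedBias_sq_le (hα : 19 / 20 ≤ α) (hα₁ : α < 1) (hC : C ∈ Set.Ico (0 : ℝ) 1)
    (h : 2 * α - 1 ≤ (2 - α) * α ^ 3 * C ^ 2) :
    (1 - whitenedBias α C ^ 2) / 2 ≤ 1 - α := by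
  have hD := one_sub_sq_mul_sq_pos ⟨by linarith, hα₁⟩ hC
  have hC₁ : 0 ≤ 1 - C ^ 2 := by nlinarith [hC.1, hC.2]
  rw [one_sub_whitenedBias_sq ⟨by linarith, hα₁⟩ hC, div_div, div_le_iff₀ (by positivity)]
  have hfirst : 1 - C ^ 2 ≤ (1 - α) * (1 - α ^ 2 * C ^ 2) := by
    have : (1 - α) * (1 - α ^ 2) ≤ (1 - α) * (1 - α ^ 2 * C ^ 2) :=
      mul_le_mul_of_nonneg_left (by nlinarith [sq_nonneg α]) (by linarith)
    linarith [one_sub_sq_le_of_unsteerable hα hα₁ h]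
  have hsecond : 1 - α ^ 4 * C ^ 2 ≤ 2 * (1 - α ^ 2 * C ^ 2) := by
    nlinarith [mul_nonneg (sq_nonneg C) (sq_nonneg (1 - α ^ 2))]
  calc (1 - C ^ 2) * (1 - α ^ 4 * C ^ 2)
      ≤ (1 - C ^ 2) * (2 * (1 - α ^ 2 * C ^ 2)) := mul_le_mul_of_nonneg_left hsecond hC₁
    _ ≤ (1 - α) * (1 - α ^ 2 * C ^ 2) * (2 * (1 - α ^ 2 * C ^ 2)) :=
      mul_le_mul_of_nonneg_right hfirst (by positivity)
    _ = (1 - α) * ((1 - α ^ 2 * C ^ 2) ^ 2 * 2) := by ring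

lemma whitened_discrim_le (hα : 19 / 20 ≤ α) (hα₁ : α < 1) (hC : C ∈ Set.Ico (0 : ℝ) 1)
    (h : 2 * α - 1 ≤ (2 - α) * α ^ 3 * C ^ 2) {y : ℝ} (hy : y ∈ Set.Icc 0 1) :
    whitenedSlope α C ^ 2 * y + α * whitenedSlope α C * (1 - y) ≤
      ((1 - whitenedBias α C ^ 2 * y) / 2) ^ 2 := by
  have hα₀ : α ∈ Set.Ioo (0 : ℝ) 1 := ⟨by linarith, hα₁⟩
  have ht₀ := whitenedSlope_nonneg hα₀ hC
  have ht := whitenedSlope_le hα₀ hC h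
  have hT₁ := one_sub_whitenedBias_sq_le hα hα₁ hC h
  have hy₁ : 0 ≤ 1 - y := sub_nonneg.2 hy.2
  obtain ⟨T, hT⟩ : ∃ T, whitenedBias α C ^ 2 = 1 - 2 * T :=
    ⟨(1 - whitenedBias α C ^ 2) / 2, by ring⟩
  rw [hT] at ht hT₁ ⊢
  replace ht : whitenedSlope α C ≤ T := by linarith
  have hT₀ : 0 ≤ T := ht₀.trans ht
  have hα_le : α * T * (1 - y) ≤ (1 - T) * T * (1 - y) := by
    gcongr
    linarith
  calc whitenedSlope α C ^ 2 * y + α * whitenedSlope α C * (1 - y)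
      ≤ T ^ 2 * y + α * T * (1 - y) := by
        have := hy.1
        have := hα₀.1
        gcongr
    _ ≤ T ^ 2 * y + (1 - T) * T * (1 - y) := by linarith
    _ ≤ ((1 - (1 - 2 * T) * y) / 2) ^ 2 := by nlinarith [sq_nonneg ((1 - y) * (1 - 2 * T))]

end PolynomialInequalities

/-- The operator `ρ_B^{-1/2} Tr_A[(Q ⊗ 𝟙) ρ_{α,θ}] ρ_B^{-1/2}` as a function of the effect `Q` of
Alice, `ρ_B` being Bob's reduced state. -/
def whitened (α θ : ℝ) : Matrix (Fin 2) (Fin 2) ℂ →ₗ[ℂ] Matrix (Fin 2) (Fin 2) ℂ where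
  toFun Q := of fun s t =>
    steered α (schmidtOp θ * Q * schmidtOp θ) s t / (√(bobWeight α θ s) * √(bobWeight α θ t) : ℝ)
  map_add' Q R := by
    ext s t
    simp only [steered, Matrix.mul_add, Matrix.add_mul, transpose_add, trace_add,
      of_apply, Matrix.add_apply, Matrix.smul_apply, smul_eq_mul]
    ring
  map_smul' c Q := by
    ext s t
    simp only [mul_smul_comm, smul_mul_assoc, steered_smul, of_apply, Matrix.smul_apply,
      smul_eq_mul, RingHom.id_apply, mul_div_assoc]

lemma whitened_apply (α θ : ℝ) (Q : Matrix (Fin 2) (Fin 2) ℂ) (s t : Fin 2) :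
    whitened α θ Q s t = steered α (schmidtOp θ * Q * schmidtOp θ) s t /
      (√(bobWeight α θ s) * √(bobWeight α θ t) : ℝ) := rfl

section Whitened

variable {α θ : ℝ}

lemma whitened_one (hb : ∀ s, 0 < bobWeight α θ s) : whitened α θ 1 = 1 := by
  ext s t
  rw [whitened_apply, mul_one, steered_schmidtOp_mul_self]
  rcases eq_or_ne s t with rfl | hst
  · rw [if_pos rfl, Real.mul_self_sqrt (hb s).le, one_apply_eq,
      div_self (Complex.ofReal_ne_zero.2 (hb s).ne')]
  · rw [if_neg hst, zero_div, one_apply_ne hst]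

lemma isHermitian_whitened {Q : Matrix (Fin 2) (Fin 2) ℂ} (hQ : Q.IsHermitian) :
    (whitened α θ Q).IsHermitian := by
  have hD : (schmidtOp θ).IsHermitian := by
    rw [schmidtOp, IsHermitian, diagonal_conjTranspose]
    congr 1
    ext s
    simp
  have hR : (schmidtOp θ * Q * schmidtOp θ).IsHermitian := by
    have := isHermitian_mul_mul_conjTranspose (schmidtOp θ) hQ
    rwa [hD.eq] at this
  have htr : star (schmidtOp θ * Q * schmidtOp θ).trace =
      (schmidtOp θ * Q * schmidtOp θ).trace := by
    rw [← trace_conjTranspose, hR.eq]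
  have hS : (steered α (schmidtOp θ * Q * schmidtOp θ)).IsHermitian := by
    rw [steered, IsHermitian, conjTranspose_add, conjTranspose_smul, conjTranspose_smul,
      conjTranspose_one, hR.transpose.eq, star_mul', htr]
    simp
  refine IsHermitian.ext fun s t => ?_
  rw [whitened_apply, whitened_apply, star_div₀, hS.apply, mul_comm (√(bobWeight α θ t))]
  simp

/-- `(x, v)` are the coordinates of the Bloch vector of `Q` along the `Z` axis, and a quarter of the
square of its distance from that axis. -/
lemma exists_bloch_coordinates {Q : Matrix (Fin 2) (Fin 2) ℂ} (hQ : Q.PosSemidef)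
    (htr : Q.trace = 1) :
    ∃ x v : ℝ, 0 ≤ v ∧ 4 * v ≤ 1 - x ^ 2 ∧ Q 0 0 = ((1 + x) / 2 : ℝ) ∧
      Q 1 1 = ((1 - x) / 2 : ℝ) ∧ Q 0 1 * Q 1 0 = v := by
  obtain ⟨a, ha⟩ : ∃ a : ℝ, Q 0 0 = a := ⟨_, (hQ.1.coe_re_apply_self 0).symm⟩
  have hone : Q 1 1 = ((1 - a : ℝ) : ℂ) := by
    rw [Complex.ofReal_sub, Complex.ofReal_one, ← htr, trace_fin_two, ha]
    ring
  have hprod : Q 0 1 * Q 1 0 = ((‖Q 1 0‖ ^ 2 : ℝ) : ℂ) := by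
    rw [← hQ.1.apply 0 1, RCLike.star_def, Complex.conj_mul', Complex.ofReal_pow]
  have hdet : ‖Q 1 0‖ ^ 2 ≤ a * (1 - a) := by
    have h := hQ.det_nonneg
    rw [det_fin_two, hprod, hone, ha] at h
    exact sub_nonneg.1 (by exact_mod_cast h)
  refine ⟨2 * a - 1, ‖Q 1 0‖ ^ 2, sq_nonneg _, by linarith, ?_, ?_, hprod⟩
  · rw [ha]
    ring_nf
  · rw [hone]
    ring_nf

lemma schmidt_zero_sq (θ : ℝ) : schmidt θ 0 ^ 2 = (1 + Real.cos (2 * θ)) / 2 := by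
  rw [schmidt, cons_val_zero, Real.cos_sq]
  ring

lemma schmidt_one_sq (θ : ℝ) : schmidt θ 1 ^ 2 = (1 - Real.cos (2 * θ)) / 2 := by
  rw [schmidt, cons_val_one, cons_val_fin_one, Real.sin_sq, Real.cos_sq]
  ring

lemma bobWeight_zero (α θ : ℝ) : bobWeight α θ 0 = (1 + α * Real.cos (2 * θ)) / 2 := by
  rw [bobWeight, schmidt_zero_sq]
  ring

lemma bobWeight_one (α θ : ℝ) : bobWeight α θ 1 = (1 - α * Real.cos (2 * θ)) / 2 := by
  rw [bobWeight, schmidt_one_sq]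
  ring

lemma whitened_apply_self (hb : ∀ s, 0 < bobWeight α θ s) (Q : Matrix (Fin 2) (Fin 2) ℂ)
    (s : Fin 2) :
    whitened α θ Q s s = (α * schmidt θ s ^ 2 * Q s s +
      (1 - α) / 2 * ∑ u, schmidt θ u ^ 2 * Q u u) / bobWeight α θ s := by
  rw [whitened_apply, Real.mul_self_sqrt (hb s).le]
  simp only [steered, schmidtOp, Matrix.add_apply, Matrix.smul_apply, transpose_apply,
    mul_diagonal, diagonal_mul, one_apply_eq, trace, diag_apply, smul_eq_mul, mul_one]
  congr 2
  · ring
  · congr 1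
    exact Finset.sum_congr rfl fun u _ => by ring

end Whitened

section PairResponse

variable {α θ : ℝ}

lemma mul_cos_two_mul_mem_Ioo (hb : ∀ s, 0 < bobWeight α θ s) :
    α * Real.cos (2 * θ) ∈ Set.Ioo (-1 : ℝ) 1 := by
  have h₀ := bobWeight_zero α θ ▸ hb 0
  have h₁ := bobWeight_one α θ ▸ hb 1
  exact ⟨by linarith, by linarith⟩

lemma whitened_zero_zero (hb : ∀ s, 0 < bobWeight α θ s) {Q : Matrix (Fin 2) (Fin 2) ℂ} {x : ℝ}
    (h₀ : Q 0 0 = ((1 + x) / 2 : ℝ)) (h₁ : Q 1 1 = ((1 - x) / 2 : ℝ)) :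
    whitened α θ Q 0 0 = ((1 + (whitenedBias α (Real.cos (2 * θ)) +
      whitenedSlope α (Real.cos (2 * θ))) * x) / 2 : ℝ) := by
  have h := mul_cos_two_mul_mem_Ioo hb
  rw [whitened_apply_self hb, Fin.sum_univ_two, h₀, h₁, whitenedBias_add_whitenedSlope h]
  norm_cast
  rw [bobWeight_zero, schmidt_zero_sq, schmidt_one_sq]
  have hplus : 1 + α * Real.cos (2 * θ) ≠ 0 := by linarith [h.1]
  field_simp
  ring

lemma whitened_one_one (hb : ∀ s, 0 < bobWeight α θ s) {Q : Matrix (Fin 2) (Fin 2) ℂ} {x : ℝ}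
    (h₀ : Q 0 0 = ((1 + x) / 2 : ℝ)) (h₁ : Q 1 1 = ((1 - x) / 2 : ℝ)) :
    whitened α θ Q 1 1 = ((1 + (whitenedBias α (Real.cos (2 * θ)) -
      whitenedSlope α (Real.cos (2 * θ))) * x) / 2 : ℝ) := by
  have h := mul_cos_two_mul_mem_Ioo hb
  rw [whitened_apply_self hb, Fin.sum_univ_two, h₀, h₁, whitenedBias_sub_whitenedSlope h]
  norm_cast
  rw [bobWeight_one, schmidt_zero_sq, schmidt_one_sq]
  have hminus : 1 - α * Real.cos (2 * θ) ≠ 0 := by linarith [h.2]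
  field_simp
  ring

lemma whitened_zero_one_mul_whitened_one_zero (hb : ∀ s, 0 < bobWeight α θ s)
    (Q : Matrix (Fin 2) (Fin 2) ℂ) :
    whitened α θ Q 0 1 * whitened α θ Q 1 0 =
      (α * whitenedSlope α (Real.cos (2 * θ)) : ℝ) * (Q 0 1 * Q 1 0) := by
  obtain ⟨hlow, hup⟩ := mul_cos_two_mul_mem_Ioo hb
  have hfactor : 1 - α ^ 2 * Real.cos (2 * θ) ^ 2 =
      (1 + α * Real.cos (2 * θ)) * (1 - α * Real.cos (2 * θ)) := by ring
  have hplus : 1 + α * Real.cos (2 * θ) ≠ 0 := by linarith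
  have hminus : 1 - α * Real.cos (2 * θ) ≠ 0 := by linarith
  have hcoeff : (α * (schmidt θ 0 * schmidt θ 1)) ^ 2 / (bobWeight α θ 0 * bobWeight α θ 1) =
      α * whitenedSlope α (Real.cos (2 * θ)) := by
    rw [bobWeight_zero, bobWeight_one, whitenedSlope, hfactor]
    rw [mul_pow, mul_pow, schmidt_zero_sq, schmidt_one_sq]
    field_simp
    ring
  have hroots : √(bobWeight α θ 0) * √(bobWeight α θ 1) * (√(bobWeight α θ 1) *
      √(bobWeight α θ 0)) = bobWeight α θ 0 * bobWeight α θ 1 := by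
    rw [mul_mul_mul_comm, mul_comm √(bobWeight α θ 1), mul_mul_mul_comm,
      Real.mul_self_sqrt (hb 0).le, Real.mul_self_sqrt (hb 1).le]
  rw [whitened_apply, whitened_apply, div_mul_div_comm, ← Complex.ofReal_mul, hroots, ← hcoeff]
  simp only [steered, schmidtOp, transpose_mul, diagonal_transpose, mul_diagonal, diagonal_mul,
    transpose_apply, Matrix.add_apply, Matrix.smul_apply, smul_eq_mul, Complex.coe_smul,
    Complex.real_smul, ne_eq, zero_ne_one, one_ne_zero, not_false_eq_true, one_apply_ne, mul_zero,
    add_zero, Complex.ofReal_div, Complex.ofReal_mul, Complex.ofReal_pow]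
  ring

lemma cos_two_mul_mem_Ico (hθ : θ ∈ Set.Ioc 0 (Real.pi / 4)) :
    Real.cos (2 * θ) ∈ Set.Ico (0 : ℝ) 1 := by
  refine ⟨Real.cos_nonneg_of_neg_pi_div_two_le_of_le (by linarith [hθ.1, Real.pi_pos])
    (by linarith [hθ.2]), ?_⟩
  rw [← Real.cos_zero]
  exact Real.cos_lt_cos_of_nonneg_of_le_pi le_rfl (by linarith [hθ.2, Real.pi_pos])
    (by linarith [hθ.1])

lemma cos_pos_of_mem_Ioc (hθ : θ ∈ Set.Ioc 0 (Real.pi / 4)) : 0 < Real.cos θ :=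
  Real.cos_pos_of_mem_Ioo ⟨by linarith [hθ.1, Real.pi_pos], by linarith [hθ.2, Real.pi_pos]⟩

lemma sin_pos_of_mem_Ioc (hθ : θ ∈ Set.Ioc 0 (Real.pi / 4)) : 0 < Real.sin θ :=
  Real.sin_pos_of_pos_of_lt_pi hθ.1 (by linarith [hθ.2, Real.pi_pos])

lemma exists_hiddenAvg_eq_whitened_of_trace_eq_one (hα : 19 / 20 ≤ α) (hα₁ : α < 1)
    (hθ : θ ∈ Set.Ioc 0 (Real.pi / 4)) (hcond : UnsteerableCond α θ)
    {Q : Matrix (Fin 2) (Fin 2) ℂ} (hQ : Q.PosSemidef) (htr : Q.trace = 1) :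
    ∃ P : (Fin 2 → ℂ) → ℝ, Measurable P ∧ (∀ ψ, P ψ ∈ Set.Icc 0 1) ∧
      hiddenAvg P = whitened α θ Q := by
  have hα₀ : α ∈ Set.Ioo (0 : ℝ) 1 := ⟨by linarith, hα₁⟩
  have hb := bobWeight_pos (Set.Ioo_subset_Icc_self hα₀) (cos_pos_of_mem_Ioc hθ).ne'
    (sin_pos_of_mem_Ioc hθ).ne'
  have hC := cos_two_mul_mem_Ico hθ
  have hineq : 2 * α - 1 ≤ (2 - α) * α ^ 3 * Real.cos (2 * θ) ^ 2 :=
    (div_le_iff₀' (mul_pos (by linarith) (pow_pos hα₀.1 3))).1 hcond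
  obtain ⟨x, v, hv, hvx, h₀, h₁, h₀₁⟩ := exists_bloch_coordinates hQ htr
  obtain ⟨hκ₀, hκ₁⟩ := whitenedBias_mem_Icc hα₀ hC
  have ht₀ := whitenedSlope_nonneg hα₀ hC
  have hdiscrim := whitened_discrim_le hα hα₁ hC hineq (y := x ^ 2) ⟨sq_nonneg x, by linarith⟩
  have hdet : (whitened α θ Q).det.re = ((1 + whitenedBias α (Real.cos (2 * θ)) * x) ^ 2 -
      (whitenedSlope α (Real.cos (2 * θ)) * x) ^ 2) / 4 -
      α * whitenedSlope α (Real.cos (2 * θ)) * v := by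
    rw [det_fin_two, whitened_zero_one_mul_whitened_one_zero hb, whitened_zero_zero hb h₀ h₁,
      whitened_one_one hb h₀ h₁, h₀₁]
    norm_cast
    ring
  set κ := whitenedBias α (Real.cos (2 * θ))
  set t := whitenedSlope α (Real.cos (2 * θ))
  have hκx : |κ * x| ≤ 1 := by
    rw [abs_mul, abs_of_nonneg hκ₀]
    exact mul_le_one₀ hκ₁ (abs_nonneg x) (abs_le_one_iff_mul_self_le_one.2 (by nlinarith))
  refine exists_hiddenAvg_eq (isHermitian_whitened hQ.1) (τ := 1 + κ * x) ?_
    (by linarith [neg_le_of_abs_le hκx]) (by linarith [le_of_abs_le hκx]) ?_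
  · rw [trace_fin_two, whitened_zero_zero hb h₀ h₁, whitened_one_one hb h₀ h₁]
    norm_cast
    ring
  · rw [hdet]
    calc (1 + κ * x) ^ 2 - 4 * (((1 + κ * x) ^ 2 - (t * x) ^ 2) / 4 - α * t * v)
        = t ^ 2 * x ^ 2 + α * t * (4 * v) := by ring
      _ ≤ t ^ 2 * x ^ 2 + α * t * (1 - x ^ 2) := by
        have := hα₀.1
        gcongr
      _ ≤ ((1 - κ ^ 2 * x ^ 2) / 2) ^ 2 := hdiscrim
      _ = ((1 + κ * x) * (2 - (1 + κ * x)) / 2) ^ 2 := by ring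

lemma exists_hiddenAvg_eq_whitened (hα : 19 / 20 ≤ α) (hα₁ : α < 1)
    (hθ : θ ∈ Set.Ioc 0 (Real.pi / 4)) (hcond : UnsteerableCond α θ)
    {Q : Matrix (Fin 2) (Fin 2) ℂ} (hQ : Q.PosSemidef) :
    ∃ f : (Fin 2 → ℂ) → ℝ, Measurable f ∧ (∀ ψ, f ψ ∈ Set.Icc 0 Q.trace.re) ∧
      hiddenAvg f = whitened α θ Q := by
  obtain ⟨T, hT⟩ : ∃ T : ℝ, Q.trace = T := ⟨_, Complex.eq_re_of_ofReal_le hQ.trace_nonneg⟩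
  have hT₀ : 0 ≤ T := by exact_mod_cast hT ▸ hQ.trace_nonneg
  rw [hT, Complex.ofReal_re]
  rcases hT₀.eq_or_lt with rfl | hpos
  · refine ⟨fun _ => 0, measurable_const, fun _ => ⟨le_rfl, le_rfl⟩, ?_⟩
    rw [hQ.trace_eq_zero_iff.1 (by simpa using hT), map_zero]
    ext s t
    simp [hiddenAvg]
  have hTne : (T : ℂ) ≠ 0 := Complex.ofReal_ne_zero.2 hpos.ne'
  obtain ⟨P, hPm, hP₁, hP⟩ := exists_hiddenAvg_eq_whitened_of_trace_eq_one hα hα₁ hθ hcond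
    (Q := (T : ℂ)⁻¹ • Q) (hQ.smul (by positivity))
    (by rw [trace_smul, hT, smul_eq_mul, inv_mul_cancel₀ hTne])
  refine ⟨fun ψ => T * P ψ, hPm.const_mul T, fun ψ => ⟨mul_nonneg hT₀ (hP₁ ψ).1,
    mul_le_of_le_one_right hT₀ (hP₁ ψ).2⟩, ?_⟩
  have hscale : hiddenAvg (fun ψ => T * P ψ) = (T : ℂ) • hiddenAvg P := by
    ext s t
    simp only [hiddenAvg, of_apply, Matrix.smul_apply, smul_eq_mul, Complex.ofReal_mul, mul_assoc]
    exact integral_const_mul _ _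
  rw [hscale, hP, map_smul, smul_inv_smul₀ hTne]

end PairResponse

/-! ### The local model -/

/-- The response of a party holding a qutrit: with probability `1/2` it follows `f`, and the
remaining probability, including the part that `f` leaves unused, is distributed according to `q`.
Here `f` is normalised to have sum at most `2`. -/
def paddedResponse {A : Type*} [Fintype A] (f q : A → ℝ) (a : A) : ℝ :=
  1 / 2 * f a + 1 / 2 * q a * (2 - ∑ a', f a')

section PaddedResponse

variable {A : Type*} [Fintype A] {q : A → ℝ}

lemma paddedResponse_nonneg {f : A → ℝ} (hf : ∀ a, 0 ≤ f a) (hf₂ : ∑ a, f a ≤ 2)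
    (hq : ∀ a, 0 ≤ q a) (a : A) : 0 ≤ paddedResponse f q a :=
  add_nonneg (mul_nonneg (by norm_num) (hf a))
    (mul_nonneg (mul_nonneg (by norm_num) (hq a)) (sub_nonneg.2 hf₂))

lemma sum_paddedResponse (f : A → ℝ) (hq : ∑ a, q a = 1) : ∑ a, paddedResponse f q a = 1 := by
  simp_rw [paddedResponse, Finset.sum_add_distrib, ← Finset.sum_mul, ← Finset.mul_sum, hq]
  ring

lemma measurable_paddedResponse {L : Type*} [MeasurableSpace L] {f : A → L → ℝ}
    (hf : ∀ a, Measurable (f a)) (q : A → ℝ) (a : A) :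
    Measurable fun l => paddedResponse (f · l) q a :=
  ((hf a).const_mul _).add
    (((Finset.measurable_sum _ fun a' _ => hf a').const_sub _).const_mul _)

lemma hiddenAvg_paddedResponse {f : A → (Fin 2 → ℂ) → ℝ} (hf : ∀ a, Measurable (f a)) {K : A → ℝ}
    (hK : ∀ a ψ, f a ψ ∈ Set.Icc 0 (K a)) (q : A → ℝ) (a : A) :
    hiddenAvg (fun ψ => paddedResponse (f · ψ) q a) =
      (1 / 2 : ℂ) • (hiddenAvg (f a) + (q a : ℂ) • ((2 : ℂ) • 1 - ∑ a', hiddenAvg (f a'))) := by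
  ext s t
  have hint (a' : A) := integrable_mul_hidden (hf a') (hK a') s t
  have hsum : Integrable fun ψ => ∑ a', (f a' ψ : ℂ) * hidden s t ψ :=
    integrable_finsetSum _ fun a' _ => hint a'
  have hrest : Integrable fun ψ => q a * hidden s t ψ - q a / 2 * ∑ a', f a' ψ * hidden s t ψ :=
    ((integrable_hidden s t).const_mul _).sub (hsum.const_mul _)
  have hexpand (ψ : Fin 2 → ℂ) : (paddedResponse (f · ψ) q a : ℂ) * hidden s t ψ =
      1 / 2 * (f a ψ * hidden s t ψ) + (q a * hidden s t ψ -
        q a / 2 * ∑ a', f a' ψ * hidden s t ψ) := by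
    rw [paddedResponse, ← Finset.sum_mul]
    push_cast
    ring
  simp only [Matrix.smul_apply, Matrix.add_apply, Matrix.sub_apply, Matrix.sum_apply, hiddenAvg,
    of_apply, hexpand, smul_eq_mul, ← integral_hidden]
  rw [integral_add ((hint a).const_mul _) hrest,
    integral_sub ((integrable_hidden s t).const_mul _) (hsum.const_mul _), integral_const_mul,
    integral_const_mul, integral_const_mul, integral_finsetSum _ fun a' _ => hint a']
  ring

end PaddedResponse

lemma exists_response_hiddenAvg_eq_whitened_erasureDual {α θ : ℝ} (hα : 19 / 20 ≤ α) (hα₁ : α < 1)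
    (hθ : θ ∈ Set.Ioc 0 (Real.pi / 4)) (hcond : UnsteerableCond α θ) {A : Type*} [Fintype A]
    {M : A → Matrix (Fin 3) (Fin 3) ℂ} (hM : ∀ a, (M a).PosSemidef) (hsum : ∑ a, M a = 1) :
    ∃ P : A → (Fin 2 → ℂ) → ℝ, (∀ a, Measurable (P a)) ∧
      (∀ ψ, (∀ a, 0 ≤ P a ψ) ∧ ∑ a, P a ψ = 1) ∧
      ∀ a, hiddenAvg (P a) = (1 / 2 : ℂ) • whitened α θ (erasureDual (M a)) := by
  have hb := bobWeight_pos (α := α) ⟨by linarith, hα₁.le⟩ (cos_pos_of_mem_Ioc hθ).ne'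
    (sin_pos_of_mem_Ioc hθ).ne'
  choose f hfm hf hfavg using fun a =>
    exists_hiddenAvg_eq_whitened hα hα₁ hθ hcond (Q := qubitBlock (M a)) ((hM a).submatrix _)
  have hblock : ∑ a, qubitBlock (M a) = 1 := by
    rw [← qubitBlock_one, ← hsum]
    ext i j
    simp [qubitBlock, Matrix.sum_apply]
  have hfsum (ψ) : ∑ a, f a ψ ≤ 2 := calc
    ∑ a, f a ψ ≤ ∑ a, (qubitBlock (M a)).trace.re := Finset.sum_le_sum fun a _ => (hf a ψ).2
    _ = 2 := by rw [← Complex.re_sum, ← trace_sum, hblock, trace_one, Fintype.card_fin]; rfl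
  have hq (a) : ((M a 2 2).re : ℂ) = M a 2 2 := (hM a).1.coe_re_apply_self 2
  have hq₀ (a) : 0 ≤ (M a 2 2).re := (Complex.le_def.1 ((hM a).diag_nonneg (i := 2))).1
  have hq₁ : ∑ a, (M a 2 2).re = 1 := by
    rw [← Complex.re_sum, ← Matrix.sum_apply, hsum, one_apply_eq, Complex.one_re]
  refine ⟨fun a ψ => paddedResponse (f · ψ) (fun a => (M a 2 2).re) a,
    fun a => measurable_paddedResponse hfm _ a,
    fun ψ => ⟨paddedResponse_nonneg (fun a => (hf a ψ).1) (hfsum ψ) hq₀,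
      sum_paddedResponse _ hq₁⟩, fun a => ?_⟩
  rw [hiddenAvg_paddedResponse hfm hf]
  simp_rw [hfavg]
  rw [← map_sum, hblock, whitened_one hb, hq, erasureDual, map_add, map_smul, whitened_one hb,
    two_smul, add_sub_cancel_right]

/-- The unnormalised probability of the central outcome when the central party holds the hidden
states `ρ^{1/2} |l n⟩`, where `ρ^{1/2}` is the diagonal matrix with entries `r`. -/
def centralWeight {N : ℕ} (r : Fin 2 → ℝ) (l : Fin N → Fin 2 → ℂ) : ℝ :=
  Complex.normSq (∑ s, ∏ n, (r s : ℂ) * ((√(gaussWeight (l n)) : ℂ) * l n s))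

section CentralWeight

variable {N : ℕ}

lemma centralWeight_eq_sum (r : Fin 2 → ℝ) (l : Fin N → Fin 2 → ℂ) :
    (centralWeight r l : ℂ) = ∑ s, ∑ t, ∏ n, (r s * r t : ℂ) * hidden s t (l n) := by
  rw [centralWeight, ← Complex.mul_conj, map_sum, Finset.sum_mul_sum]
  refine Finset.sum_congr rfl fun s _ => Finset.sum_congr rfl fun t _ => ?_
  rw [map_prod, ← Finset.prod_mul_distrib]
  refine Finset.prod_congr rfl fun n _ => ?_
  have hsqrt : (√(gaussWeight (l n)) : ℂ) * √(gaussWeight (l n)) = gaussWeight (l n) := by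
    exact_mod_cast Real.mul_self_sqrt (gaussWeight_nonneg _)
  simp only [hidden, ← hsqrt, map_mul, Complex.conj_ofReal, RCLike.star_def]
  ring

lemma continuous_centralWeight (r : Fin 2 → ℝ) : Continuous (centralWeight (N := N) r) := by
  unfold centralWeight
  have := continuous_gaussWeight
  fun_prop

lemma integral_centralWeight_mul_prod (r : Fin 2 → ℝ) {f : Fin N → (Fin 2 → ℂ) → ℝ}
    (hf : ∀ n, Measurable (f n)) (hf₁ : ∀ n ψ, f n ψ ∈ Set.Icc 0 1) :
    ((∫ l, centralWeight r l * ∏ n, f n (l n) : ℝ) : ℂ) =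
      ∑ s, ∑ t, ∏ n, (r s * r t : ℂ) * hiddenAvg (f n) s t := by
  have hint (s t : Fin 2) : Integrable fun l : Fin N → Fin 2 → ℂ =>
      ∏ n, (r s * r t : ℂ) * ((f n (l n) : ℂ) * hidden s t (l n)) :=
    Integrable.fintype_prod (f := fun n ψ => (r s * r t : ℂ) * ((f n ψ : ℂ) * hidden s t ψ))
      fun n => (integrable_mul_hidden (hf n) (hf₁ n) s t).const_mul _
  have hexpand (l : Fin N → Fin 2 → ℂ) : ((centralWeight r l * ∏ n, f n (l n) : ℝ) : ℂ) =
      ∑ s, ∑ t, ∏ n, (r s * r t : ℂ) * ((f n (l n) : ℂ) * hidden s t (l n)) := by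
    rw [Complex.ofReal_mul, centralWeight_eq_sum, Complex.ofReal_prod]
    simp_rw [Finset.sum_mul, ← Finset.prod_mul_distrib, mul_assoc, mul_comm (hidden _ _ _)]
  rw [← integral_complex_ofReal]
  simp_rw [hexpand]
  rw [integral_finsetSum _ fun s _ => integrable_finsetSum _ fun t _ => hint s t]
  refine Finset.sum_congr rfl fun s _ => ?_
  rw [integral_finsetSum _ fun t _ => hint s t]
  refine Finset.sum_congr rfl fun t _ => ?_
  rw [integral_fintype_prod_volume_eq_prod
    fun n (ψ : Fin 2 → ℂ) => (r s * r t : ℂ) * ((f n ψ : ℂ) * hidden s t ψ)]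
  simp only [integral_const_mul, hiddenAvg, of_apply]

lemma integral_centralWeight (hN : N ≠ 0) (r : Fin 2 → ℝ) :
    ∫ l : Fin N → Fin 2 → ℂ, centralWeight r l = ∑ s, (r s ^ 2) ^ N := by
  have h := integral_centralWeight_mul_prod (N := N) r (f := fun _ _ => 1)
    (fun _ => measurable_const) (fun _ _ => ⟨zero_le_one, le_rfl⟩)
  have havg : hiddenAvg (fun _ => 1) = 1 := by
    ext s t
    simp [hiddenAvg, integral_hidden]
  simp only [Finset.prod_const_one, mul_one, havg, one_apply, mul_ite, mul_zero, Finset.prod_const,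
    Finset.card_univ, Fintype.card_fin, ite_pow, zero_pow hN, Finset.sum_ite_eq, Finset.mem_univ,
    if_true] at h
  simp only [pow_two]
  exact_mod_cast h

lemma exists_isProbabilityMeasure_integral_prod_eq (hN : N ≠ 0) {r : Fin 2 → ℝ}
    (hr : ∑ s, (r s ^ 2) ^ N ≠ 0) :
    ∃ ν : Measure (Fin N → Fin 2 → ℂ), IsProbabilityMeasure ν ∧
      ∀ f : Fin N → (Fin 2 → ℂ) → ℝ, (∀ n, Measurable (f n)) → (∀ n ψ, f n ψ ∈ Set.Icc 0 1) →
        ((∫ l, ∏ n, f n (l n) ∂ν : ℝ) : ℂ) = ((∑ s, (r s ^ 2) ^ N : ℝ) : ℂ)⁻¹ *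
          ∑ s, ∑ t, ∏ n, (r s * r t : ℂ) * hiddenAvg (f n) s t := by
  obtain ⟨ν, hν, hint⟩ := exists_isProbabilityMeasure_integral_mul
    (continuous_centralWeight r).measurable (fun l => Complex.normSq_nonneg _)
    ((integral_centralWeight hN r).trans_ne hr)
  refine ⟨ν, hν, fun f hf hf₁ => ?_⟩
  rw [← integral_centralWeight_mul_prod r hf hf₁, hint, integral_centralWeight hN,
    Complex.ofReal_mul, inv_mul_cancel_left₀ (Complex.ofReal_ne_zero.2 hr)]

end CentralWeight

lemma isFullyLocal_rhoGME {N : ℕ} (hN : N ≠ 0) {α θ : ℝ} (hα : 19 / 20 ≤ α) (hα₁ : α < 1)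
    (hθ : θ ∈ Set.Ioc 0 (Real.pi / 4)) (hcond : UnsteerableCond α θ) :
    IsFullyLocal (rhoGME N α θ) := by
  intro X A _ M hM
  have hα₀ : α ∈ Set.Icc (0 : ℝ) 1 := ⟨by linarith, hα₁.le⟩
  have hc := (cos_pos_of_mem_Ioc hθ).ne'
  have hs := (sin_pos_of_mem_Ioc hθ).ne'
  have hb := bobWeight_pos hα₀ hc hs
  choose P hPm hP hPavg using fun n x =>
    exists_response_hiddenAvg_eq_whitened_erasureDual hα hα₁ hθ hcond (hM n x).1 (hM n x).2
  have hresp (n ψ) : IsResponse fun x a => P n x a ψ := fun x => hP n x ψ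
  have hsq (s) : √(bobWeight α θ s) ^ 2 = bobWeight α θ s := Real.sq_sqrt (hb s).le
  obtain ⟨ν, hν, hint⟩ := exists_isProbabilityMeasure_integral_prod_eq hN
    (r := fun s => √(bobWeight α θ s))
    (by simpa only [hsq] using (sum_bobWeight_pow_pos hα₀ hc hs).ne')
  refine ⟨Fin N → Fin 2 → ℂ, inferInstance, ν, fun n l x a => P n x a (l n), hν,
    fun n l => hresp n (l n), fun n x a => (hPm n x a).comp (measurable_pi_apply n),
    fun x a => ?_⟩
  have hentry (n s t) : (√(bobWeight α θ s) * √(bobWeight α θ t) : ℂ) *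
      ((1 / 2 : ℂ) • whitened α θ (erasureDual (M n (x n) (a n)))) s t =
      1 / 2 * steered α (schmidtOp θ * erasureDual (M n (x n) (a n)) * schmidtOp θ) s t := by
    have hne (u) : (√(bobWeight α θ u) : ℂ) ≠ 0 :=
      Complex.ofReal_ne_zero.2 (Real.sqrt_pos.2 (hb u)).ne'
    rw [Matrix.smul_apply, whitened_apply, Complex.ofReal_mul, smul_eq_mul, mul_left_comm,
      mul_div_cancel₀ _ (mul_ne_zero (hne s) (hne t))]
  have hlocal := hint (fun n => P n (x n) (a n)) (fun n => hPm n (x n) (a n)) fun n ψ =>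
    ⟨(hresp n ψ (x n)).1 (a n), isResponse_le_one (hresp n ψ) (x n) (a n)⟩
  rw [born, trace_rhoGME_mul_tensor, trace_starNetwork_rhoPair hN, ← Complex.ofReal_re (∫ _, _ ∂_),
    hlocal]
  simp only [hPavg, hentry, hsq, Finset.prod_mul_distrib, ← Finset.mul_sum, Finset.prod_const,
    Finset.card_univ, Fintype.card_fin, _root_.one_div_pow]
  rw [mul_left_comm, mul_assoc]

/-! ### The parameter range -/

lemma exists_unsteerableCond {α : ℝ} (hα : 1 / 2 ≤ α) (hα₁ : α < 1) :
    ∃ θ ∈ Set.Ioc (0 : ℝ) (Real.pi / 4), UnsteerableCond α θ := by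
  have hbound : (2 * α - 1) / ((2 - α) * α ^ 3) < 1 := by
    rw [div_lt_one (mul_pos (by linarith) (by positivity))]
    have : 0 < (1 - α) ^ 3 * (1 + α) := mul_pos (pow_pos (by linarith) 3) (by linarith)
    linarith
  have hcont : Continuous fun θ : ℝ => Real.cos (2 * θ) ^ 2 := by fun_prop
  have hlim : Tendsto (fun θ : ℝ => Real.cos (2 * θ) ^ 2) (𝓝[>] 0) (𝓝 1) := by
    simpa using (hcont.tendsto 0).mono_left nhdsWithin_le_nhds
  have hmem : ∀ᶠ θ in 𝓝[>] (0 : ℝ), θ ∈ Set.Ioc 0 (Real.pi / 4) :=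
    Ioc_mem_nhdsGT (by positivity)
  obtain ⟨θ, hθ, hlt⟩ := (hmem.and (hlim.eventually (lt_mem_nhds hbound))).exists
  exact ⟨θ, hθ, hlt.le⟩

lemma tan_sq_le_one_of_mem_Ioc {θ : ℝ} (hθ : θ ∈ Set.Ioc 0 (Real.pi / 4)) :
    Real.tan θ ^ 2 ≤ 1 := by
  have hcos := cos_pos_of_mem_Ioc hθ
  have h₂ := (cos_two_mul_mem_Ico hθ).1
  rw [Real.cos_two_mul'] at h₂
  rw [Real.tan_eq_sin_div_cos, div_pow, div_le_one (by positivity)]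
  linarith

lemma three_quarters_le_pow {N : ℕ} (hN : N ≠ 0) {α : ℝ} (hα : 1 - 1 / (10 * N) < α) :
    3 / 4 ≤ α ^ N := by
  have hN₁ : (1 : ℝ) ≤ N := by exact_mod_cast Nat.one_le_iff_ne_zero.2 hN
  have hdefect : N * (1 - α) ≤ 1 / 10 := calc
    N * (1 - α) ≤ N * (1 / (10 * N)) := by gcongr; linarith
    _ = 1 / 10 := by field_simp
  have hα₀ : 0 ≤ α := by nlinarith
  have hbernoulli := one_add_mul_le_pow (a := α - 1) (by linarith) N
  rw [add_sub_cancel] at hbernoulli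
  linarith

lemma nineteen_twentieths_le {N : ℕ} (hN : 2 ≤ N) {α : ℝ} (hα : 1 - 1 / (10 * N) < α) :
    19 / 20 ≤ α := by
  have hN₂ : (2 : ℝ) ≤ N := by exact_mod_cast hN
  have : 1 / (10 * (N : ℝ)) ≤ 1 / 20 := one_div_le_one_div_of_le (by norm_num) (by linarith)
  linarith

lemma half_lt_fidelityPure_filtered_rhoGME {N : ℕ} (hN : N ≠ 0) {α θ : ℝ}
    (hα : α ∈ Set.Icc (0 : ℝ) 1) (hαN : 3 / 4 ≤ α ^ N) (hc : Real.cos θ ≠ 0)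
    (hs : Real.sin θ ≠ 0) :
    1 / 2 < fidelityPure (filtered (Real.tan θ) (rhoGME N α θ)) (ghz N) := by
  have hplus : α ^ N ≤ ((1 + α) / 2) ^ N := pow_le_pow_left₀ hα.1 (by linarith [hα.2]) N
  have hminus : 0 ≤ ((1 - α) / 2) ^ N := pow_nonneg (by linarith [hα.2]) N
  have hreal : (1 / 2 : ℝ) < 1 / 2 * (α ^ N + ((1 + α) / 2) ^ N + ((1 - α) / 2) ^ N) := by
    linarith
  rw [fidelityPure_filtered_rhoGME hN hα hc hs]
  simpa only [Complex.ofReal_div, Complex.ofReal_one, Complex.ofReal_ofNat] using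
    Complex.real_lt_real.2 hreal

lemma tendsto_fidelityPure_filtered_rhoGME {N : ℕ} (hN : N ≠ 0) {θ : ℝ → ℝ}
    (hc : ∀ α, Real.cos (θ α) ≠ 0) (hs : ∀ α, Real.sin (θ α) ≠ 0) :
    Tendsto (fun α => fidelityPure (filtered (Real.tan (θ α)) (rhoGME N α (θ α))) (ghz N))
      (𝓝[<] 1) (𝓝 1) := by
  have hcont : Continuous fun α : ℝ =>
      ((1 / 2 * (α ^ N + ((1 + α) / 2) ^ N + ((1 - α) / 2) ^ N) : ℝ) : ℂ) := by fun_prop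
  have hone : ((1 / 2 * (1 ^ N + ((1 + 1) / 2) ^ N + ((1 - 1) / 2) ^ N) : ℝ) : ℂ) = 1 := by
    norm_num [hN]
  refine (hone ▸ (hcont.tendsto 1).mono_left nhdsWithin_le_nhds).congr' ?_
  filter_upwards [Ico_mem_nhdsLT one_pos] with α hα
  exact (fidelityPure_filtered_rhoGME hN (Set.Ico_subset_Icc_self hα) (hc α) (hs α)).symm

lemma one_sub_one_div_mem_Ico {N : ℕ} (hN : N ≠ 0) :
    (1 - 1 / (10 * N) : ℝ) ∈ Set.Ico (0 : ℝ) 1 := by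
  have hN₁ : (1 : ℝ) ≤ N := by exact_mod_cast Nat.one_le_iff_ne_zero.2 hN
  have hle : 1 / (10 * (N : ℝ)) ≤ 1 := (div_le_one (by positivity)).2 (by linarith)
  have hpos : 0 < 1 / (10 * (N : ℝ)) := by positivity
  exact ⟨by linarith, by linarith⟩

end

end HiddenNonlocality

theorem mainTheorem5 (N : ℕ) (hN : 2 ≤ N) :
    (∀ α ∈ Set.Icc (0 : ℝ) 1, ∀ θ ∈ Set.Ioc (0 : ℝ) (Real.pi / 4),
      IsState (rhoGME N α θ) ∧
      IsState (filtered (Real.tan θ) (rhoGME N α θ)) ∧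
      fidelityPure (filtered (Real.tan θ) (rhoGME N α θ)) (ghz N) =
        ((1 / 2 * (α ^ N + ((1 + α) / 2) ^ N + ((1 - α) / 2) ^ N) : ℝ) : ℂ)) ∧
    (∀ θ : ℝ → ℝ, (∀ α, θ α ∈ Set.Ioc (0 : ℝ) (Real.pi / 4)) →
      Tendsto (fun α => fidelityPure (filtered (Real.tan (θ α)) (rhoGME N α (θ α))) (ghz N))
        (𝓝[<] 1) (𝓝 1)) ∧
    ∃ α₀ ∈ Set.Ico (0 : ℝ) 1, ∀ α ∈ Set.Ioo α₀ 1,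
      (∃ θ ∈ Set.Ioc (0 : ℝ) (Real.pi / 4), UnsteerableCond α θ) ∧
      ∀ θ ∈ Set.Ioc (0 : ℝ) (Real.pi / 4),
        IsGME (rhoGME N α θ) ∧
        (UnsteerableCond α θ → IsFullyLocal (rhoGME N α θ)) ∧
        IsGMNL (filtered (Real.tan θ) (rhoGME N α θ)) ∧
        IsSeqGMNL (rhoGME N α θ) := by
  have hN₀ : N ≠ 0 := by omega
  have hc {θ : ℝ} (hθ : θ ∈ Set.Ioc 0 (Real.pi / 4)) := (cos_pos_of_mem_Ioc hθ).ne'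
  have hs {θ : ℝ} (hθ : θ ∈ Set.Ioc 0 (Real.pi / 4)) := (sin_pos_of_mem_Ioc hθ).ne'
  have hstate {α θ : ℝ} (hα : α ∈ Set.Icc 0 1) (hθ : θ ∈ Set.Ioc 0 (Real.pi / 4)) :=
    isState_rhoGME hN₀ hα (hc hθ) (hs hθ)
  have hsuccess {α θ : ℝ} (hα : α ∈ Set.Icc 0 1) (hθ : θ ∈ Set.Ioc 0 (Real.pi / 4)) :=
    trace_filterAll_rhoGME_ne_zero hN₀ hα (hc hθ) (hs hθ)
  refine ⟨fun α hα θ hθ => ⟨hstate hα hθ, isState_filtered (hstate hα hθ).1 (hsuccess hα hθ),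
    fidelityPure_filtered_rhoGME hN₀ hα (hc hθ) (hs hθ)⟩,
    fun θ hθ => tendsto_fidelityPure_filtered_rhoGME hN₀ (fun α => hc (hθ α)) fun α => hs (hθ α),
    1 - 1 / (10 * N), one_sub_one_div_mem_Ico hN₀, fun α hα => ?_⟩
  have hα₀ := nineteen_twentieths_le hN hα.1
  have hα' : α ∈ Set.Icc (0 : ℝ) 1 := ⟨by linarith, hα.2.le⟩
  have hαN := three_quarters_le_pow hN₀ hα.1
  refine ⟨exists_unsteerableCond (by linarith) hα.2, fun θ hθ => ?_⟩
  have hnonlocal := not_isBilocal_born_filtered_rhoGME hN₀ hα' hαN (hc hθ) (hs hθ)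
  have hpovm := fun _ : Fin N => isPOVM_svetMeas N
  exact ⟨isGME_of_half_lt_fidelityPure_filtered (hstate hα' hθ)
      (half_lt_fidelityPure_filtered_rhoGME hN₀ hα' hαN (hc hθ) (hs hθ)),
    isFullyLocal_rhoGME hN₀ hα₀ hα.2 hθ, ⟨2, 2, _, hpovm, hnonlocal⟩,
    isSeqGMNL_of_not_isBilocal_born_filtered (tan_sq_le_one_of_mem_Ioc hθ) (hstate hα' hθ).1
      (hsuccess hα' hθ) hpovm hnonlocal⟩
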